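/- Let $p$ be a prime, $n\ge 1$, and $T=\mathbb F_p^{\,n}$. Call $\sigma\in \mathrm{GL}(n,p)$ admissible if its minimal polynomial has degree $n$ and $-I\in\langle\sigma\rangle$ (where $-I=I$ if $p=2$), and let $\mathbf M(n,p)$ be any set of representatives of the $\mathrm{GL}(n,p)$-conjugacy classes of admissible elements. For admissible $\sigma$ let $T\rtimes\langle\sigma\rangle$ be the semidirect product in which $\sigma^{-1}t\sigma=\sigma(t)$ for $t\in T$, and let $t(-I)$ denote the product of $t\in T$ and $-I\in\langle\sigma\rangle$ in it. Call $t\in T$ a cyclic vector for $\sigma$ if $t,\sigma(t),\dots,\sigma^{n-1}(t)$ is a basis of $T$. A Cayley map $\mathrm{Cay}(G,S,\rho)$ is given by a generating set $S=S^{-1}\not\ni 1$ of a group $G$ and a permutation $\rho$ of $S$ that is a single cycle on all of $S$. Its darts are the pairs $(g,s)$, $g\in G$, $s\in S$, where $(g,s)$ is the arc from $g$ to $gs$, with local rotation $(g,s)\mapsto(g,\rho(s))$ and dart reversal $(g,s)\mapsto(gs,s^{-1})$. For a group $X=\langle r,\ell\rangle$ with $\ell$ of order $2$, the algebraic map $\mathcal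 M(X;r,\ell)$ has dart set $X$, local rotation $x\mapsto xr$ and dart reversal $x\mapsto x\ell$. An isomorphism of maps is a bijection of the darts that commutes with the local rotations and with the dart reversals. A Cayley map is regular if its group of automorphisms (in this sense) acts regularly on its darts. Then the following hold. (1) Every $\sigma\in\mathbf M(n,p)$ has a cyclic vector, and for every cyclic vector $t$ for $\sigma$ the element $t(-I)$ has order $2$ and $T\rtimes\langle\sigma\rangle=\langle\sigma,\,t(-I)\rangle$; thus $\mathcal M(T\rtimes\langle\sigma\rangle;\,\sigma,\,t(-I))$ is defined. (2) For every regular Cayley map $\mathcal C$ of a group $G\cong\mathbb Z_p^n$ there is $\sigma\in\mathbf M(n,p)$ such that $\mathcal C\cong\mathcal M(T\rtimes\langle\sigma\rangle;\,\sigma,\,t(-I))$ for every cyclic vector $t$ for $\sigma$. (3) Conversely, for every $\sigma\in\mathbf M(n,p)$ and every cyclic vector $t$ for $\sigma$, the map $\mathcal M(T\rtimes\langle\sigma\rangle;\,\sigma,\,t(-I))$ is isomorphic to a regular Cayley map of $\mathbb Z_p^n$. (4) If $\sigma_1\ne\sigma_2$ are in $\mathbf M(n,p)$ and $t_i$ is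 a cyclic vector for $\sigma_i$ $(i=1,2)$, then $\mathcal M(T\rtimes\langle\sigma_1\rangle;\,\sigma_1,\,t_1(-I))\not\cong\mathcal M(T\rtimes\langle\sigma_2\rangle;\,\sigma_2,\,t_2(-I))$. -/

import Mathlib

/-! ### Orientable maps in combinatorial form -/

/-- The data of an oriented map: a set of darts (arcs) `D`, the local rotation `rot`, and the
dart-reversing permutation `rev`.  The vertices, edges and faces are the orbits of `rot`,
of `rev` and of their product.  It is only used for the two concrete constructions `CayleyMap.toMap`
and `algebraicMap` below, in which `rev` is an involution and the graph is connected. -/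
structure RotationSystem where
  D : Type*
  rot : Equiv.Perm D
  rev : Equiv.Perm D

namespace RotationSystem

/-- Orientation preserving isomorphism of maps: a bijection of the darts which respects the local
rotations and the dart reversals. -/
def Isomorphic (M N : RotationSystem) : Prop :=
  ∃ f : M.D ≃ N.D, (∀ d, f (M.rot d) = N.rot (f d)) ∧ (∀ d, f (M.rev d) = N.rev (f d))

/-- The group of orientation preserving automorphisms of a map, acting on its darts. -/
def automorphismGroup (M : RotationSystem) : Subgroup (Equiv.Perm M.D) where
  carrier := {f | (∀ d, f (M.rot d) = M.rot (f d)) ∧ (∀ d, f (M.rev d) = M.rev (f d))}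
  one_mem' := ⟨fun _ => rfl, fun _ => rfl⟩
  mul_mem' := by
    rintro f g ⟨hf1, hf2⟩ ⟨hg1, hg2⟩
    exact ⟨fun d => by simp [hf1, hg1], fun d => by simp [hf2, hg2]⟩
  inv_mem' := by
    rintro f ⟨hf1, hf2⟩
    refine ⟨fun d => ?_, fun d => ?_⟩
    · rw [Equiv.Perm.inv_eq_iff_eq, hf1]
      exact congrArg _ (Equiv.apply_symm_apply f d).symm
    · rw [Equiv.Perm.inv_eq_iff_eq, hf2]
      exact congrArg _ (Equiv.apply_symm_apply f d).symm

/-- A map is regular if its automorphism group acts regularly on the darts. -/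
def IsRegular (M : RotationSystem) : Prop :=
  ∀ d e : M.D, ∃! f : M.automorphismGroup, (f : Equiv.Perm M.D) d = e

end RotationSystem

/-! ### Cayley maps -/

/-- The data of a Cayley map `Cay(G, S, ρ)`: a generating set `S = S⁻¹` of `G` with `1 ∉ S` and
a cyclic permutation `ρ` of `S` (a permutation of `S` consisting of one single cycle). -/
structure CayleyMap (G : Type*) [Group G] where
  S : Set G
  one_notMem : (1 : G) ∉ S
  inv_mem : ∀ s ∈ S, s⁻¹ ∈ S
  closure_eq_top : Subgroup.closure S = ⊤
  ρ : Equiv.Perm S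
  cyclic : ρ.IsCycleOn Set.univ

namespace CayleyMap

variable {G : Type*} [Group G]

/-- The map `Cay(G, S, ρ)`.  The pair `(g, s)` is the dart from `g` to `g s`; its rotation is
`(g, ρ s)`, and its reversal is the dart `(g s, s⁻¹)` from `g s` to `g`. -/
def toMap (C : CayleyMap G) : RotationSystem where
  D := G × C.S
  rot := (Equiv.refl G).prodCongr C.ρ
  rev := Function.Involutive.toPerm
    (fun d => (d.1 * d.2.1, ⟨d.2.1⁻¹, C.inv_mem _ d.2.2⟩))
    (fun d => by ext <;> simp)

/-- A regular Cayley map. -/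
def IsRegular (C : CayleyMap G) : Prop := C.toMap.IsRegular

end CayleyMap

/-! ### Algebraic maps -/

section AlgebraicMap

variable (X : Type*) [Group X]

/-- The algebraic map `M(X; r, ℓ)`: the darts are the elements of `X`, the vertices, edges and
faces are the cosets `x⟨r⟩`, `x⟨ℓ⟩`, `x⟨rℓ⟩`, and `X` acts by left multiplication. -/
def algebraicMap (r l : X) : RotationSystem where
  D := X
  rot := Equiv.mulRight r
  rev := Equiv.mulRight l

/-- The condition under which `M(X; r, ℓ)` is a map: `X = ⟨r, ℓ⟩` with `ℓ` of order two. -/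
def IsAlgebraicMapData (r l : X) : Prop :=
  Subgroup.closure {r, l} = ⊤ ∧ orderOf l = 2

end AlgebraicMap

/-! ### The affine groups `T ⋊ ⟨σ⟩` -/

/-- The group `GL(n, p)` of invertible linear transformations of `T = 𝔽_p ^ n`. -/
abbrev GLnp (n p : ℕ) : Type := LinearMap.GeneralLinearGroup (ZMod p) (Fin n → ZMod p)

/-- The action of `⟨σ⟩` on `T` that defines `T ⋊ ⟨σ⟩`.  In this semidirect product
`c⁻¹ t c = c(t)` for `t ∈ T` and `c ∈ ⟨σ⟩`, see `AffineGroup.conj_eq`. -/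
def affineAction {n p : ℕ} (σ : GLnp n p) :
    Subgroup.zpowers σ →* MulAut (Multiplicative (Fin n → ZMod p)) where
  toFun c := AddEquiv.toMultiplicative
    (LinearMap.GeneralLinearGroup.toLinearEquiv (c⁻¹ : Subgroup.zpowers σ).1).toAddEquiv
  map_one' := by ext v; simp
  map_mul' c d := by
    have h : (c * d)⁻¹ = c⁻¹ * d⁻¹ := by
      rw [mul_inv_rev]
      exact IsMulCommutative.is_comm.comm d⁻¹ c⁻¹
    rw [h]
    rfl

/-- The semidirect product `T ⋊ ⟨σ⟩`, a subgroup of the affine group `AGL(n, p)`. -/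
abbrev AffineGroup {n p : ℕ} (σ : GLnp n p) : Type :=
  Multiplicative (Fin n → ZMod p) ⋊[affineAction σ] Subgroup.zpowers σ

namespace AffineGroup

variable {n p : ℕ} (σ : GLnp n p)

/-- An element of `T`, as an element of `T ⋊ ⟨σ⟩`. -/
def trans (t : Fin n → ZMod p) : AffineGroup σ := SemidirectProduct.inl (Multiplicative.ofAdd t)

/-- An element of `⟨σ⟩`, as an element of `T ⋊ ⟨σ⟩`. -/
def lin (c : GLnp n p) (hc : c ∈ Subgroup.zpowers σ) : AffineGroup σ :=
  SemidirectProduct.inr ⟨c, hc⟩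

theorem conj_eq (c : GLnp n p) (hc : c ∈ Subgroup.zpowers σ) (t : Fin n → ZMod p) :
    (lin σ c hc)⁻¹ * trans σ t * lin σ c hc = trans σ (c.1 t) := by
  have h := SemidirectProduct.inl_aut (φ := affineAction σ) (⟨c, hc⟩⁻¹) (Multiplicative.ofAdd t)
  rw [inv_inv] at h
  rw [trans, lin, ← map_inv]
  refine h.symm.trans ?_
  simp only [affineAction, trans, MonoidHom.coe_mk, OneHom.coe_mk, inv_inv]
  rfl

end AffineGroup

/-! ### The set `M(n, p)` -/

/-- The minimal polynomial of `σ` has degree `n`, and `-I` is a power of `σ`. -/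
def IsAdmissible {n p : ℕ} (σ : GLnp n p) : Prop :=
  (minpoly (ZMod p) σ.1).natDegree = n ∧ (-1 : GLnp n p) ∈ Subgroup.zpowers σ

/-- `R` is a set of representatives of the conjugacy classes of the elements `σ` of `GL(n, p)`
with minimal polynomial of degree `n` and with `-I ∈ ⟨σ⟩`. -/
def IsRepresentativeSet {n p : ℕ} (R : Set (GLnp n p)) : Prop :=
  (∀ σ ∈ R, IsAdmissible σ) ∧ ∀ σ, IsAdmissible σ → ∃! τ, τ ∈ R ∧ IsConj σ τ

/-- The vectors `t, σ(t), …, σ^(n-1)(t)` form a basis of `T`. -/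
def IsCyclicVector {n p : ℕ} (σ : GLnp n p) (t : Fin n → ZMod p) : Prop :=
  LinearIndependent (ZMod p) (fun i : Fin n => (σ ^ (i : ℕ)).1 t) ∧
    Submodule.span (ZMod p) (Set.range fun i : Fin n => (σ ^ (i : ℕ)).1 t) = ⊤

/-- The element `t(-I)` of `T ⋊ ⟨σ⟩`. -/
def arcReversal {n p : ℕ} (σ : GLnp n p) (hσ : IsAdmissible σ) (t : Fin n → ZMod p) :
    AffineGroup σ :=
  AffineGroup.trans σ t * AffineGroup.lin σ (-1) hσ.2

/-- The algebraic map `M(T ⋊ ⟨σ⟩; σ, t(-I))`. -/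
def standardMap {n p : ℕ} (σ : GLnp n p) (hσ : IsAdmissible σ) (t : Fin n → ZMod p) :
    RotationSystem :=
  algebraicMap (AffineGroup σ) (AffineGroup.lin σ σ (Subgroup.mem_zpowers σ)) (arcReversal σ hσ t)

/-! Let X be the automorphism group of a regular Cayley map of G. Evaluation at a base dart
identifies the map with M(X; r, l), where r rotates about a vertex and l reverses the dart. The
translations form a copy of G with X = G⟨r⟩ and G ∩ ⟨r⟩ = 1. The Cayley graph is simple, so ⟨r⟩ ∩
l⟨r⟩l = 1 (`CayleyMap.exists_algebraicMap`).

The crux, `exists_isAdaptedComplement`, is a normal elementary abelian complement Q of ⟨r⟩ with l =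
xc, x ∈ Q, and c ∈ ⟨r⟩ inverting Q. For p = 2 it is G itself, with c = 1. For odd p, Itô's theorem
on products of abelian groups gives an abelian normal subgroup K with X/K abelian. Modulo K the
involution l lies in ⟨r⟩, whence X = K⟨r⟩ and K is generated by the ⟨r⟩-conjugates of x. That K has
exponent p reduces to x ^ p = 1, a commutator computation in `pow_eq_one_of_mul_mem`.

Identify Q with T. Conjugation by r⁻¹ becomes a linear map τ, x a cyclic vector (because r and l
generate X), and c the scalar -1, so τ is admissible. The action of ⟨r⟩ is faithful, so X ≅ T ⋊ ⟨τ⟩.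
Passing to the representative σ of τ and to any cyclic vector is a change of coordinates, since the
centralizer of σ is transitive on cyclic vectors (`IsCyclicVector.exists_commute`).

Conversely, the standard map is the Cayley map of T on the ⟨σ⟩-orbit of t, closed under negation
because -I ∈ ⟨σ⟩. An isomorphism between two standard maps yields a group isomorphism matching the
generators; it carries T to T and so conjugates σ₁ to σ₂ (`isConj_of_mulEquiv`). -/

/-! ### Cyclic vectors -/

open Polynomial in
/-- A vector whose orbit spans the space: the minimal polynomial has full degree and the first
`finrank` vectors of the orbit already span. -/
theorem Module.End.natDegree_minpoly_of_span_orbit {K V : Type*} [Field K] [AddCommGroup V]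
    [Module K V] [FiniteDimensional K V] (f : Module.End K V) (v : V)
    (h : Submodule.span K (Set.range fun i : ℕ => (f ^ i) v) = ⊤) :
    (minpoly K f).natDegree = Module.finrank K V ∧
      Submodule.span K (Set.range fun i : Fin (Module.finrank K V) => (f ^ (i : ℕ)) v) = ⊤ := by
  set m := minpoly K f with hm
  have hmonic : m.Monic := minpoly.monic (Algebra.IsIntegral.isIntegral f)
  have hle : m.natDegree ≤ Module.finrank K V := by
    rw [← LinearMap.charpoly_natDegree f]
    exact natDegree_le_of_dvd (LinearMap.minpoly_dvd_charpoly f) f.charpoly_monic.ne_zero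
  have hspan : Submodule.span K (Set.range fun i : Fin m.natDegree => (f ^ (i : ℕ)) v) = ⊤ := by
    rw [eq_top_iff, ← h, Submodule.span_le]
    rintro _ ⟨i, rfl⟩
    -- Division by the minimal polynomial writes each iterate in terms of the first `m.natDegree`
    -- ones.
    have h1 : f ^ i = aeval f ((X ^ i : K[X]) %ₘ m) := by
      rw [modByMonic_eq_sub_mul_div]
      simp [hm, minpoly.aeval]
    show (f ^ i) v ∈ _
    by_cases hz : (X ^ i : K[X]) %ₘ m = 0
    · rw [h1, hz]; simp
    have hlt : ((X ^ i : K[X]) %ₘ m).natDegree < m.natDegree :=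
      natDegree_lt_natDegree hz (degree_modByMonic_lt _ hmonic)
    rw [h1, aeval_eq_sum_range' hlt, LinearMap.sum_apply]
    refine Submodule.sum_mem _ fun j hj => ?_
    rw [LinearMap.smul_apply]
    exact Submodule.smul_mem _ _ (Submodule.subset_span ⟨⟨j, Finset.mem_range.1 hj⟩, rfl⟩)
  have hge : Module.finrank K V ≤ m.natDegree := by
    have := finrank_range_le_card (R := K) (fun i : Fin m.natDegree => (f ^ (i : ℕ)) v)
    rwa [Set.finrank, hspan, finrank_top, Fintype.card_fin] at this
  have he := le_antisymm hle hge
  exact ⟨he, he ▸ hspan⟩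

open Polynomial in
/-- An endomorphism has a vector whose first `deg (minpoly)` iterates are independent. -/
theorem Module.End.exists_linearIndependent_orbit {K V : Type*} [Field K] [AddCommGroup V]
    [Module K V] [FiniteDimensional K V] (f : Module.End K V) :
    ∃ v : V, LinearIndependent K (fun i : Fin (minpoly K f).natDegree => (f ^ (i : ℕ)) v) := by
  -- Over `K[X]` some vector has the annihilator of the whole module, generated by the minimal
  -- polynomial. A relation among the first iterates is a multiple of it of smaller degree, hence
  -- zero.
  obtain ⟨v, hv⟩ := Module.exists_ker_toSpanSingleton_eq_annihilator K[X] (Module.AEval' f)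
  rw [← span_minpoly_eq_annihilator] at hv
  obtain ⟨w, rfl⟩ := (Module.AEval'.of f).surjective v
  refine ⟨w, Fintype.linearIndependent_iff.2 fun c hc i => ?_⟩
  set q : K[X] := ∑ i : Fin (minpoly K f).natDegree, C (c i) * X ^ (i : ℕ) with hq
  have hqw : aeval f q w = 0 := by
    simpa [hq, LinearMap.sum_apply, Algebra.algebraMap_eq_smul_one] using hc
  have hdvd : minpoly K f ∣ q := by
    rw [← Ideal.mem_span_singleton, ← hv, LinearMap.mem_ker, LinearMap.toSpanSingleton_apply]
    exact hqw
  have hdeg : q.degree < (minpoly K f).degree := by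
    rw [degree_eq_natDegree (minpoly.ne_zero (Algebra.IsIntegral.isIntegral f))]
    exact degree_sum_fin_lt c
  have hq0 : q = 0 := eq_zero_of_dvd_of_degree_lt hdvd hdeg
  have := congrArg (fun r => r.coeff (i : ℕ)) hq0
  simpa [hq, finsetSum_coeff, coeff_X_pow, Fin.val_inj] using this

/-- An endomorphism with `deg (minpoly) = n` on `n`-dimensional space has a cyclic vector. -/
theorem exists_isCyclicVector {n p : ℕ} [Fact p.Prime] {σ : GLnp n p} (hσ : IsAdmissible σ) :
    ∃ t, IsCyclicVector σ t := by
  obtain ⟨v, hv⟩ := Module.End.exists_linearIndependent_orbit σ.1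
  rw [hσ.1] at hv
  refine ⟨v, by simpa using hv, ?_⟩
  have := hv.span_eq_top_of_card_eq_finrank' (by simp)
  simpa using this

theorem isCyclicVector_of_span {n p : ℕ} [Fact p.Prime] {σ : GLnp n p} {t : Fin n → ZMod p}
    (h : Submodule.span (ZMod p) (Set.range fun i : ℕ => (σ.1 ^ i) t) = ⊤) :
    (minpoly (ZMod p) σ.1).natDegree = n ∧ IsCyclicVector σ t := by
  obtain ⟨h1, h2⟩ := Module.End.natDegree_minpoly_of_span_orbit σ.1 t h
  rw [Module.finrank_fin_fun] at h1 h2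
  have h3 : Submodule.span (ZMod p) (Set.range fun i : Fin n => (σ ^ (i : ℕ)).1 t) = ⊤ := by
    simpa using h2
  exact ⟨h1, linearIndependent_of_top_le_span_of_card_eq_finrank h3.ge (by simp), h3⟩

theorem IsCyclicVector.ne_zero {n p : ℕ} [Fact p.Prime] {σ : GLnp n p} {t : Fin n → ZMod p}
    (h : IsCyclicVector σ t) (hn : 0 < n) : t ≠ 0 := by
  simpa using h.1.ne_zero ⟨0, hn⟩

/-- The closure property of additive subgroups that detects a cyclic vector. -/
theorem IsCyclicVector.mem_of_forall_pow_mem {n p : ℕ} [Fact p.Prime] {σ : GLnp n p}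
    {t : Fin n → ZMod p} (h : IsCyclicVector σ t) (H : AddSubgroup (Fin n → ZMod p))
    (hH : ∀ i : ℕ, (σ ^ i).1 t ∈ H) (v : Fin n → ZMod p) : v ∈ H := by
  -- Over the prime field every additive subgroup is a subspace.
  have h1 : Submodule.span (ZMod p) (Set.range fun i : Fin n => (σ ^ (i : ℕ)).1 t) ≤
      AddSubgroup.toZModSubmodule p H :=
    Submodule.span_le.2 (by rintro _ ⟨i, rfl⟩; exact hH i)
  rw [h.2] at h1
  exact h1 (Submodule.mem_top : v ∈ ⊤)

/-- Two cyclic vectors of `σ` are related by an element of the centralizer of `σ`. -/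
theorem IsCyclicVector.exists_commute {n p : ℕ} [Fact p.Prime] {σ : GLnp n p}
    {s t : Fin n → ZMod p} (hs : IsCyclicVector σ s) (ht : IsCyclicVector σ t) :
    ∃ B : GLnp n p, Commute B σ ∧ B.1 s = t := by
  have hmem : t ∈ Submodule.span (ZMod p) (Set.range fun i : Fin n => (σ ^ (i : ℕ)).1 s) :=
    hs.2 ▸ Submodule.mem_top
  obtain ⟨c, hc⟩ := (Submodule.mem_span_range_iff_exists_fun _).1 hmem
  -- The polynomial in σ that takes s to t. Its range contains every σ^i(t), so it is invertible.
  set f : Module.End (ZMod p) (Fin n → ZMod p) := ∑ i, c i • σ.1 ^ (i : ℕ) with hf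
  have hfs : f s = t := by simpa [hf, LinearMap.sum_apply] using hc
  have hcomm : Commute f σ.1 := by
    refine Commute.sum_left _ _ _ fun i _ => Commute.smul_left ?_ _
    exact (Commute.refl _).pow_left _
  have hsurj : Function.Surjective f := by
    rw [← LinearMap.range_eq_top, eq_top_iff, ← ht.2, Submodule.span_le]
    rintro _ ⟨i, rfl⟩
    refine ⟨(σ.1 ^ (i : ℕ)) s, ?_⟩
    have := LinearMap.congr_fun (hcomm.pow_right i).eq s
    simpa [hfs] using this
  obtain ⟨B, hB⟩ : IsUnit f :=
    (Module.End.isUnit_iff f).2 ⟨LinearMap.injective_iff_surjective.2 hsurj, hsurj⟩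
  exact ⟨B, Units.ext (by simpa [hB] using hcomm.eq), by rw [hB, hfs]⟩

/-! ### Products of two abelian subgroups, and the complement for p = 2 -/

section Factorization

variable {X : Type*} [Group X]

/-- **Itô's theorem**: a product of two commutative subgroups is metabelian. -/
theorem exists_normal_commutative_of_factorization (A B : Subgroup X)
    (hA : ∀ a ∈ A, ∀ b ∈ A, a * b = b * a) (hB : ∀ a ∈ B, ∀ b ∈ B, a * b = b * a)
    (hAB : ∀ x, ∃ a ∈ A, ∃ b ∈ B, x = a * b) :
    ∃ K : Subgroup X, K.Normal ∧ (∀ a ∈ K, ∀ b ∈ K, a * b = b * a) ∧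
      ∀ x y, x * y * x⁻¹ * y⁻¹ ∈ K := by
  have hBA : ∀ x, ∃ a ∈ A, ∃ b ∈ B, x = b * a := fun x => by
    obtain ⟨a, ha, b, hb, h⟩ := hAB x⁻¹
    exact ⟨a⁻¹, A.inv_mem ha, b⁻¹, B.inv_mem hb, by rw [← inv_inv x, h, mul_inv_rev]⟩
  set S : Set X := {x | ∃ a ∈ A, ∃ b ∈ B, x = a * b * a⁻¹ * b⁻¹} with hS
  -- conjugation by `A` changes only the `B`-entry of a commutator, and vice versa
  have conjA : ∀ c ∈ A, ∀ b ∈ B, ∃ b' ∈ B, ∀ a ∈ A,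
      c * (a * b * a⁻¹ * b⁻¹) * c⁻¹ = a * b' * a⁻¹ * b'⁻¹ := by
    intro c hc b hb
    obtain ⟨a', ha', b', hb', h⟩ := hBA (c * b * c⁻¹)
    refine ⟨b', hb', fun a ha => ?_⟩
    have e1 : c * (a * b * a⁻¹ * b⁻¹) * c⁻¹ = a * (c * b * c⁻¹) * a⁻¹ * (c * b * c⁻¹)⁻¹ := by
      have := hA c hc a ha
      have h2 : c * a⁻¹ = a⁻¹ * c := hA c hc _ (A.inv_mem ha)
      calc c * (a * b * a⁻¹ * b⁻¹) * c⁻¹ = (c * a) * b * a⁻¹ * b⁻¹ * c⁻¹ := by group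
        _ = a * c * b * c⁻¹ * (c * a⁻¹) * b⁻¹ * c⁻¹ := by rw [this]; group
        _ = _ := by rw [h2]; group
    have e2 : a' * a⁻¹ = a⁻¹ * a' := hA a' ha' _ (A.inv_mem ha)
    rw [e1, h]
    calc a * (b' * a') * a⁻¹ * (b' * a')⁻¹ = a * b' * (a' * a⁻¹) * a'⁻¹ * b'⁻¹ := by group
      _ = _ := by rw [e2]; group
  have conjB : ∀ d ∈ B, ∀ a ∈ A, ∃ a' ∈ A, ∀ b ∈ B,
      d * (a * b * a⁻¹ * b⁻¹) * d⁻¹ = a' * b * a'⁻¹ * b⁻¹ := by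
    intro d hd a ha
    obtain ⟨a', ha', b', hb', h⟩ := hAB (d * a * d⁻¹)
    refine ⟨a', ha', fun b hb => ?_⟩
    have e1 : d * (a * b * a⁻¹ * b⁻¹) * d⁻¹ = (d * a * d⁻¹) * b * (d * a * d⁻¹)⁻¹ * b⁻¹ := by
      have := hB d hd b hb
      have h2 : d * b⁻¹ = b⁻¹ * d := hB d hd _ (B.inv_mem hb)
      calc d * (a * b * a⁻¹ * b⁻¹) * d⁻¹ = d * a * d⁻¹ * (d * b) * a⁻¹ * b⁻¹ * d⁻¹ := by group
        _ = d * a * d⁻¹ * b * d * a⁻¹ * d⁻¹ * (d * b⁻¹) * d⁻¹ := by rw [this]; group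
        _ = _ := by rw [h2]; group
    have e2 : b' * b = b * b' := hB b' hb' _ hb
    rw [e1, h]
    calc (a' * b') * b * (a' * b')⁻¹ * b⁻¹ = a' * (b' * b) * b'⁻¹ * a'⁻¹ * b⁻¹ := by group
      _ = _ := by rw [e2]; group
  have hSconj : ∀ g, ∀ s ∈ S, g * s * g⁻¹ ∈ S := by
    rintro g s ⟨a, ha, b, hb, rfl⟩
    obtain ⟨c, hc, d, hd, rfl⟩ := hAB g
    obtain ⟨a', ha', h1⟩ := conjB d hd a ha
    obtain ⟨b', hb', h2⟩ := conjA c hc b hb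
    refine ⟨a', ha', b', hb', ?_⟩
    rw [← h2 a' ha', ← h1 b hb]
    group
  have hnormal : (Subgroup.closure S).Normal := by
    refine ⟨fun x hx g => ?_⟩
    induction hx using Subgroup.closure_induction with
    | mem s hs => exact Subgroup.subset_closure (hSconj g s hs)
    | one => simp
    | mul x y _ _ hx hy =>
      have := Subgroup.mul_mem _ hx hy
      convert this using 1; group
    | inv x _ hx =>
      have := Subgroup.inv_mem _ hx
      convert this using 1; group
  have hcommS : ∀ s ∈ S, ∀ t ∈ S, s * t = t * s := by
    rintro _ ⟨a, ha, b, hb, rfl⟩ _ ⟨c, hc, d, hd, rfl⟩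
    -- Conjugating [a, b] by c⁻¹ and d⁻¹ in either order gives [a', b'], because each conjugation
    -- changes only one entry. Hence [a, b] commutes with [c, d].
    obtain ⟨b', hb', hA'⟩ := conjA c⁻¹ (A.inv_mem hc) b hb
    obtain ⟨a', ha', hB'⟩ := conjB d⁻¹ (B.inv_mem hd) a ha
    have e1 := hA' a ha
    have e2 := hB' b' hb'
    have e3 := hB' b hb
    have e4 := hA' a' ha'
    rw [← e1] at e2
    rw [← e3, ← e2] at e4
    set s := a * b * a⁻¹ * b⁻¹
    simp only [inv_inv] at e4
    calc s * (c * d * c⁻¹ * d⁻¹)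
        = (c * d) * (d⁻¹ * (c⁻¹ * s * c) * d) * (c * d)⁻¹ * (c * d * c⁻¹ * d⁻¹) := by group
      _ = _ := by rw [← e4]; group
  refine ⟨Subgroup.closure S, hnormal, fun a ha b hb => ?_, fun x y => ?_⟩
  · have h1 : Subgroup.closure S ≤ Subgroup.centralizer S :=
      (Subgroup.closure_le _).2 fun s hs t ht => hcommS t ht s hs
    have h2 : Subgroup.closure S ≤ Subgroup.centralizer (Subgroup.closure S : Set X) :=
      (Subgroup.closure_le _).2 fun s hs t ht => (h1 ht s hs).symm
    exact h2 hb a ha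
  · have hab : ∀ a ∈ A, ∀ b ∈ B,
        (a : X ⧸ Subgroup.closure S) * b = (b : X ⧸ Subgroup.closure S) * a := fun a ha b hb => by
      have : ((a * b * a⁻¹ * b⁻¹ : X) : X ⧸ Subgroup.closure S) = 1 :=
        (QuotientGroup.eq_one_iff _).2 (Subgroup.subset_closure ⟨a, ha, b, hb, rfl⟩)
      simp only [QuotientGroup.mk_mul, QuotientGroup.mk_inv] at this
      rw [mul_inv_eq_one, mul_inv_eq_iff_eq_mul] at this
      exact this
    obtain ⟨a, ha, b, hb, rfl⟩ := hAB x
    obtain ⟨c, hc, d, hd, rfl⟩ := hAB y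
    have e1 : Commute (a : X ⧸ Subgroup.closure S) c := by
      simpa [Commute, SemiconjBy] using congrArg (QuotientGroup.mk' (Subgroup.closure S)) (hA a ha c hc)
    have e2 : Commute (b : X ⧸ Subgroup.closure S) d := by
      simpa [Commute, SemiconjBy] using congrArg (QuotientGroup.mk' (Subgroup.closure S)) (hB b hb d hd)
    have e3 : Commute (a : X ⧸ Subgroup.closure S) d := hab a ha d hd
    have e4 : Commute (b : X ⧸ Subgroup.closure S) c := (hab c hc b hb).symm
    have e5 : Commute ((a : X ⧸ Subgroup.closure S) * b) (c * d) :=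
      (e1.mul_right e3).mul_left (e4.mul_right e2)
    rw [← QuotientGroup.eq_one_iff]
    simp only [QuotientGroup.mk_mul, QuotientGroup.mk_inv]
    rw [mul_inv_eq_one, mul_inv_eq_iff_eq_mul]
    simpa using e5.eq

/-- If `X = ⟨r, l⟩` with `l = x c`, `c ∈ ⟨r⟩`, then every element of `X` is the product of an element
of `⟨r⟩` and one satisfying a given property of `x` that is stable under the group operations and
under conjugation by `⟨r⟩`. -/
theorem exists_mul_zpowers_of_closure {r l x c : X} (hrl : Subgroup.closure {r, l} = ⊤)
    (hc : c ∈ Subgroup.zpowers r) (hl : l = x * c) {P : X → Prop} (one : P 1)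
    (mul : ∀ a b, P a → P b → P (a * b)) (inv : ∀ a, P a → P a⁻¹)
    (conj : ∀ a, P a → ∀ y ∈ Subgroup.zpowers r, P (y * a * y⁻¹)) (hx : P x) (g : X) :
    ∃ k, P k ∧ ∃ y ∈ Subgroup.zpowers r, g = k * y := by
  have hg : g ∈ Subgroup.closure {r, l} := hrl ▸ Subgroup.mem_top g
  induction hg using Subgroup.closure_induction with
  | mem g hg =>
    rcases hg with rfl | rfl
    · exact ⟨1, one, _, Subgroup.mem_zpowers _, (one_mul _).symm⟩
    · exact ⟨x, hx, c, hc, hl⟩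
  | one => exact ⟨1, one, 1, one_mem _, (one_mul _).symm⟩
  | mul g h _ _ hg hh =>
    obtain ⟨k, hk, y, hy, rfl⟩ := hg
    obtain ⟨k', hk', y', hy', rfl⟩ := hh
    exact ⟨k * (y * k' * y⁻¹), mul _ _ hk (conj _ hk' y hy), y * y', mul_mem hy hy', by group⟩
  | inv g _ hg =>
    obtain ⟨k, hk, y, hy, rfl⟩ := hg
    exact ⟨y⁻¹ * k⁻¹ * y⁻¹⁻¹, conj _ (inv _ hk) _ (inv_mem hy), y⁻¹, inv_mem hy, by group⟩

theorem mul_comm_of_mem_zpowers {r a b : X} (ha : a ∈ Subgroup.zpowers r)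
    (hb : b ∈ Subgroup.zpowers r) : a * b = b * a := by
  obtain ⟨i, rfl⟩ := ha
  obtain ⟨j, rfl⟩ := hb
  exact zpow_mul_comm r i j

theorem card_eq_of_factorization (A B : Subgroup X) (hAB : ∀ x, ∃ a ∈ A, ∃ b ∈ B, x = a * b)
    (h : ∀ a ∈ A, a ∈ B → a = 1) : Nat.card X = Nat.card A * Nat.card B := by
  refine (Subgroup.isComplement'_of_disjoint_and_mul_eq_univ ?_ ?_).card_mul_card.symm
  · exact Subgroup.disjoint_def.2 fun {x} hx hy => h x hx hy
  · refine Set.eq_univ_of_forall fun x => ?_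
    obtain ⟨a, ha, b, hb, rfl⟩ := hAB x
    exact Set.mul_mem_mul ha hb

/-- Data of a normal elementary abelian complement of `⟨r⟩`, adapted to `l`. -/
structure IsAdaptedComplement (p : ℕ) (r l : X) (Q : Subgroup X) : Prop where
  normal : Q.Normal
  comm : ∀ a ∈ Q, ∀ b ∈ Q, a * b = b * a
  pow_eq_one : ∀ a ∈ Q, a ^ p = 1
  eq_one : ∀ a ∈ Q, a ∈ Subgroup.zpowers r → a = 1
  exists_mul : ∀ g, ∃ a ∈ Q, ∃ y ∈ Subgroup.zpowers r, g = a * y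
  exists_inversion : ∃ x ∈ Q, ∃ c ∈ Subgroup.zpowers r, l = x * c ∧ ∀ a ∈ Q, c * a * c⁻¹ = a⁻¹

/-- Squares in G are trivial: writing l, and then yl, as an element of G times one of ⟨r⟩ and
squaring the G-part, `hcore` forces l ∈ G and yly⁻¹ ∈ G. These conjugates generate G, so G is
normal; inversion on G is the identity, which allows c = 1. -/
theorem isAdaptedComplement_two {G : Subgroup X} {r l : X}
    (hcomm : ∀ a ∈ G, ∀ b ∈ G, a * b = b * a) (hG : ∀ a ∈ G, a ^ 2 = 1)
    (hG1 : ∀ a ∈ G, a ∈ Subgroup.zpowers r → a = 1)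
    (hX : ∀ g, ∃ a ∈ G, ∃ y ∈ Subgroup.zpowers r, g = a * y)
    (hrl : Subgroup.closure {r, l} = ⊤)
    (hcore : ∀ y ∈ Subgroup.zpowers r, l * y * l ∈ Subgroup.zpowers r → y = 1) :
    IsAdaptedComplement 2 r l G := by
  have hsq : ∀ a ∈ G, a * a = 1 := fun a ha => by rw [← sq]; exact hG a ha
  have hlG : l ∈ G := by
    obtain ⟨s, hs, y, hy, h⟩ := hX l
    have hsl : s = l * y⁻¹ := by rw [h]; group
    have h1 : l * y⁻¹ * l = y := by
      have h2 := hsq s hs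
      rw [hsl] at h2
      calc l * y⁻¹ * l = (l * y⁻¹ * (l * y⁻¹)) * y := by group
        _ = y := by rw [h2, one_mul]
    have h3 : y = 1 := inv_eq_one.1 (hcore y⁻¹ (inv_mem hy) (by rwa [h1]))
    rw [h, h3, mul_one]
    exact hs
  have hlc : ∀ y ∈ Subgroup.zpowers r, y * l * y⁻¹ ∈ G := by
    intro y hy
    obtain ⟨s, hs, z, hz, h⟩ := hX (y * l)
    have hsl : s = y * l * z⁻¹ := by rw [h]; group
    have h1 : l * (z⁻¹ * y) * l = (z⁻¹ * y)⁻¹ := by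
      have h2 := hsq s hs
      rw [hsl] at h2
      calc l * (z⁻¹ * y) * l = y⁻¹ * (y * l * z⁻¹ * (y * l * z⁻¹)) * z := by group
        _ = _ := by rw [h2]; group
    have hzy : z⁻¹ * y ∈ Subgroup.zpowers r := mul_mem (inv_mem hz) hy
    have h3 : z⁻¹ * y = 1 := hcore _ hzy (by rw [h1]; exact inv_mem hzy)
    rw [inv_mul_eq_one.1 h3] at hsl
    rwa [← hsl]
  have hconj : ∀ a ∈ G, ∀ y ∈ Subgroup.zpowers r, y * a * y⁻¹ ∈ G := by
    intro a ha
    -- The property P, that all ⟨r⟩-conjugates lie in G, is stable under the group operations and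
    -- under ⟨r⟩, unlike bare membership in G.
    obtain ⟨k, hk, y, hy, h⟩ := exists_mul_zpowers_of_closure (c := 1) (x := l)
      (P := fun g => ∀ y ∈ Subgroup.zpowers r, y * g * y⁻¹ ∈ G) hrl (one_mem _) (mul_one l).symm
      (by simp) (fun a b ha hb y hy => by simpa [mul_assoc] using mul_mem (ha y hy) (hb y hy))
      (fun a ha y hy => by simpa [mul_assoc] using inv_mem (ha y hy))
      (fun a ha y hy z hz => by simpa [mul_assoc] using ha (z * y) (mul_mem hz hy)) hlc a
    have hkG : k ∈ G := by simpa using hk 1 (one_mem _)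
    have : y = 1 := hG1 y (by rw [← inv_mul_eq_iff_eq_mul.2 h]; exact mul_mem (inv_mem hkG) ha) hy
    rw [h, this, mul_one]
    exact hk
  refine ⟨⟨fun a ha g => ?_⟩, hcomm, hG, hG1, hX, l, hlG, 1, one_mem _, (mul_one l).symm,
    fun a ha => ?_⟩
  · obtain ⟨b, hb, y, hy, rfl⟩ := hX g
    have := mul_mem (mul_mem hb (hconj a ha y hy)) (inv_mem hb)
    simpa [mul_assoc] using this
  · rw [one_mul, inv_one, mul_one, eq_inv_iff_mul_eq_one]
    exact hsq a ha

end Factorization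

/-! ### The complement for odd p -/

section OddFactorization

variable {X : Type*} [Group X]

/-- Collection when the commutator w = [z, x] is central in ⟨x, z⟩: moving the copies of z to the
right past those of x produces i(i-1)/2 factors w. -/
theorem mul_pow_eq_of_commutator {x z w : X} (hz : z * x * z⁻¹ = w * x) (hwx : Commute w x)
    (hwz : Commute w z) (i : ℕ) : (x * z) ^ i = w ^ (i.choose 2) * x ^ i * z ^ i := by
  have hzx : z * x = w * x * z := by rw [← hz]; group
  have hzi : ∀ i : ℕ, z ^ i * x = w ^ i * x * z ^ i := by
    intro i
    induction i with
    | zero => simp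
    | succ i ih =>
      calc z ^ (i + 1) * x = z * (z ^ i * x) := by rw [pow_succ', mul_assoc]
        _ = z * w ^ i * x * z ^ i := by rw [ih]; group
        _ = w ^ i * (z * x) * z ^ i := by rw [← (hwz.pow_left i).eq]; group
        _ = w ^ (i + 1) * x * z ^ (i + 1) := by rw [hzx, pow_succ w, pow_succ' z]; group
  induction i with
  | zero => simp
  | succ i ih =>
    have hc : (i + 1).choose 2 = i.choose 2 + i := by
      rw [Nat.choose_succ_succ', Nat.choose_one_right, add_comm]
    calc (x * z) ^ (i + 1) = w ^ (i.choose 2) * x ^ i * (z ^ i * x) * z := by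
          rw [pow_succ, ih]; group
      _ = w ^ (i.choose 2) * (x ^ i * w ^ i) * x * z ^ i * z := by rw [hzi]; group
      _ = _ := by
        rw [← (hwx.pow_pow i i).eq, hc, pow_add, pow_succ, pow_succ]
        simp only [mul_assoc]

/-- A cyclic section bounds the index of an elementary abelian subgroup. -/
theorem relIndex_dvd_of_isCyclic_quotient {p : ℕ} (K G : Subgroup X) [K.Normal]
    [IsCyclic (X ⧸ K)] (hG : ∀ a ∈ G, a ^ p = 1) : K.relIndex G ∣ p := by
  have h1 := Subgroup.relIndex_ker G (QuotientGroup.mk' K)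
  rw [QuotientGroup.ker_mk'] at h1
  rw [h1, ← IsCyclic.exponent_eq_card]
  refine Monoid.exponent_dvd_of_forall_pow_eq_one ?_
  rintro ⟨_, a, ha, rfl⟩
  ext
  simp [← QuotientGroup.mk_pow, hG a ha]

variable [Finite X]

/-- A complement of an elementary abelian group: `x ∈ K` has order dividing `p` if `x z` lies in an
elementary abelian group of the same order as `K`. -/
theorem pow_eq_one_of_mul_mem {p : ℕ} (hp : p.Prime) (hp2 : p ≠ 2) (K G : Subgroup X) [K.Normal]
    [IsCyclic (X ⧸ K)] (hK : ∀ a ∈ K, ∀ b ∈ K, a * b = b * a)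
    (hGc : ∀ a ∈ G, ∀ b ∈ G, a * b = b * a) (hG : ∀ a ∈ G, a ^ p = 1)
    (hcard : Nat.card K = Nat.card G) {x z : X} (hx : x ∈ K) (hz : z ^ p = 1) (hxz : x * z ∈ G) :
    x ^ p = 1 := by
  -- Since |K| = |G|, the bound on [G : G ∩ K] is also one on [K : G ∩ K].
  have hindex : G.relIndex K ∣ p := by
    have h1 := relIndex_dvd_of_isCyclic_quotient K G hG
    have h2 : Nat.card (G.subgroupOf K) * G.relIndex K = Nat.card K := Subgroup.card_mul_index _
    have h3 : Nat.card (K.subgroupOf G) * K.relIndex G = Nat.card G := Subgroup.card_mul_index _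
    have h4 : Nat.card (G.subgroupOf K) = Nat.card (K.subgroupOf G) := by
      rw [← Subgroup.inf_subgroupOf_right G K, ← Subgroup.inf_subgroupOf_right K G,
        Nat.card_congr (Subgroup.subgroupOfEquivOfLe inf_le_right).toEquiv,
        Nat.card_congr (Subgroup.subgroupOfEquivOfLe inf_le_right).toEquiv, inf_comm]
    rw [h4, hcard, ← h3] at h2
    rwa [Nat.eq_of_mul_eq_mul_left Nat.card_pos h2]
  have hconj : ∀ a ∈ K, z * a * z⁻¹ ∈ K := fun a ha => ‹K.Normal›.conj_mem a ha z
  -- the homomorphism `k ↦ [z, k]`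
  let D : K →* X := MonoidHom.mk' (fun k => z * k * z⁻¹ * (k : X)⁻¹) fun a b => by
    have h1 := hK _ (hconj b b.2) _ (inv_mem a.2)
    have h2 := hK _ (inv_mem a.2) _ (inv_mem b.2)
    calc z * (a * b : X) * z⁻¹ * (a * b : X)⁻¹
        = z * a * z⁻¹ * (z * b * z⁻¹ * ((b : X)⁻¹ * (a : X)⁻¹)) := by group
      _ = z * a * z⁻¹ * ((z * b * z⁻¹ * (a : X)⁻¹) * (b : X)⁻¹) := by rw [← h2]; group
      _ = _ := by rw [h1]; group
  have hD : ∀ k, D k = z * k * z⁻¹ * (k : X)⁻¹ := fun _ => rfl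
  -- An element of G ∩ K commutes with xz and with x, hence with z, so it lies in the kernel of `D`.
  have hcardD : Nat.card D.range ∣ p := by
    rw [← Subgroup.index_ker]
    refine (Subgroup.index_dvd_of_le ?_).trans hindex
    intro k hk
    have hkG : (k : X) ∈ G := hk
    rw [MonoidHom.mem_ker, hD, mul_inv_eq_one, mul_inv_eq_iff_eq_mul]
    have h1 := hGc _ hxz _ hkG
    have h2 := hK _ hx _ k.2
    have : x * (z * k) = x * (k * z) := by
      rw [← mul_assoc, h1, ← mul_assoc, ← mul_assoc, h2]
    exact mul_left_cancel this
  have : Fact p.Prime := ⟨hp⟩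
  have : IsCyclic D.range := isCyclic_of_card_dvd_prime hcardD
  have hDK : ∀ k, D k ∈ K := fun k => mul_mem (hconj k k.2) (inv_mem k.2)
  -- Conjugation by z on a cyclic group is a power map w ↦ w^m.
  let c : D.range →* D.range :=
    ((MulAut.conj z).toMonoidHom.comp D.range.subtype).codRestrict D.range (by
      rintro ⟨_, k, rfl⟩
      refine ⟨⟨_, hconj k k.2⟩, ?_⟩
      simp [hD, mul_assoc])
  obtain ⟨m, hm⟩ := MonoidHom.map_cyclic c
  set w : X := D ⟨x, hx⟩ with hw
  have hwD : w ∈ D.range := ⟨_, rfl⟩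
  have hwp : w ^ p = 1 := by
    obtain ⟨j, hj⟩ := hcardD
    have := pow_card_eq_one' (x := (⟨w, hwD⟩ : D.range))
    have h2 : w ^ Nat.card D.range = 1 := congrArg Subtype.val this
    rw [hj, pow_mul, h2, one_pow]
  have hzw : ∀ j : ℤ, z * w ^ j * z⁻¹ = (w ^ j) ^ m := fun j => by
    have := congrArg Subtype.val (hm ((⟨w, hwD⟩ : D.range) ^ j))
    simpa [c] using this
  have hzi : ∀ i : ℕ, z ^ i * w * (z ^ i)⁻¹ = w ^ (m ^ i) := by
    intro i
    induction i with
    | zero => simp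
    | succ i ih =>
      rw [pow_succ' z, pow_succ m, zpow_mul, ← hzw, ← ih]
      group
  -- From z^p = 1, w = w^(m^p), which is w^m by Fermat's little theorem.
  have hwz : Commute w z := by
    have h1 := hzi p
    rw [hz, one_mul, inv_one, mul_one] at h1
    obtain ⟨j, hj⟩ : (p : ℤ) ∣ m ^ p - m := by
      rw [← ZMod.intCast_zmod_eq_zero_iff_dvd]; simp
    have h2 : w ^ m = w := by
      have : w ^ (m ^ p) = w ^ m := by
        rw [show m ^ p = p * j + m by rw [← hj]; ring, zpow_add, zpow_mul]
        simp [hwp]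
      rw [← this, ← h1]
    have h3 := hzw 1
    rw [zpow_one, h2, mul_inv_eq_iff_eq_mul] at h3
    exact h3.symm
  have hzx : z * x * z⁻¹ = w * x := by rw [hw, hD]; group
  have h := mul_pow_eq_of_commutator hzx (hK _ (hDK _) _ hx) hwz p
  have hch : w ^ p.choose 2 = 1 := by
    -- Here p odd is essential: p divides p(p-1)/2.
    obtain ⟨j, hj⟩ := hp.dvd_choose_self two_ne_zero (lt_of_le_of_ne hp.two_le (Ne.symm hp2))
    rw [hj, pow_mul, hwp, one_pow]
  rwa [hG _ hxz, hch, hz, one_mul, mul_one, eq_comm] at h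

theorem exists_isAdaptedComplement_odd {p : ℕ} (hp : p.Prime) (hp2 : p ≠ 2) {G : Subgroup X}
    {r l : X} (hcomm : ∀ a ∈ G, ∀ b ∈ G, a * b = b * a) (hG : ∀ a ∈ G, a ^ p = 1)
    (hG1 : ∀ a ∈ G, a ∈ Subgroup.zpowers r → a = 1)
    (hX : ∀ g, ∃ a ∈ G, ∃ y ∈ Subgroup.zpowers r, g = a * y)
    (hl : l * l = 1) (hrl : Subgroup.closure {r, l} = ⊤)
    (hcore : ∀ y ∈ Subgroup.zpowers r, l * y * l ∈ Subgroup.zpowers r → y = 1) :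
    ∃ Q, IsAdaptedComplement p r l Q := by
  obtain ⟨K, hKn, hK, hquot⟩ := exists_normal_commutative_of_factorization G (Subgroup.zpowers r)
    hcomm (fun a ha b hb => mul_comm_of_mem_zpowers ha hb) hX
  -- modulo `K`, the element `l` agrees with some `c ∈ ⟨r⟩`
  obtain ⟨s, hs, y, hy, hsy⟩ := hX l
  obtain ⟨j, hj⟩ : ∃ j, p = 2 * j + 1 := hp.odd_of_ne_two hp2
  obtain ⟨c, hc, x, hx, hlx⟩ : ∃ c ∈ Subgroup.zpowers r, ∃ x ∈ K, l = x * c := by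
    -- Modulo K, y^p = s^p y^p = l^p, so l y^p = l^(p+1) = 1 because p + 1 is even.
    refine ⟨(y ^ p)⁻¹, inv_mem (pow_mem hy p), l * y ^ p, ?_, by group⟩
    have hq : Commute (s : X ⧸ K) y := by
      have := (QuotientGroup.eq_one_iff _).2 (hquot s y)
      simp only [QuotientGroup.mk_mul, QuotientGroup.mk_inv] at this
      rwa [mul_inv_eq_one, mul_inv_eq_iff_eq_mul] at this
    have hsp : (s : X ⧸ K) ^ p = 1 := by rw [← QuotientGroup.mk_pow, hG s hs]; rfl
    have hll : ((s : X ⧸ K) * y) ^ 2 = 1 := by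
      rw [← QuotientGroup.mk_mul, ← hsy, sq, ← QuotientGroup.mk_mul, hl]; rfl
    rw [← QuotientGroup.eq_one_iff, QuotientGroup.mk_mul, QuotientGroup.mk_pow]
    calc (l : X ⧸ K) * (y : X ⧸ K) ^ p = (l : X ⧸ K) * ((s : X ⧸ K) * y) ^ p := by
          rw [hq.mul_pow, hsp, one_mul]
      _ = ((s : X ⧸ K) * y) ^ 2 * (((s : X ⧸ K) * y) ^ 2) ^ j := by
          rw [hj, hsy, QuotientGroup.mk_mul, pow_succ', pow_mul, ← mul_assoc, sq]
      _ = 1 := by rw [hll]; simp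
  have hKconj : ∀ a ∈ K, ∀ g, g * a * g⁻¹ ∈ K := fun a ha g => hKn.conj_mem a ha g
  have hXK : ∀ g, ∃ a ∈ K, ∃ y ∈ Subgroup.zpowers r, g = a * y :=
    exists_mul_zpowers_of_closure (P := (· ∈ K)) hrl hc hlx (one_mem _)
      (fun _ _ => mul_mem) (fun _ => inv_mem) (fun a ha y _ => hKconj a ha y) hx
  -- Such a y commutes with x and c, hence with l, and then lyl = y ∈ ⟨r⟩.
  have hcentral : ∀ y ∈ Subgroup.zpowers r, (∀ a ∈ K, y * a = a * y) → y = 1 := by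
    intro y hy h
    refine hcore y hy ?_
    have : y * l = l * y := by
      rw [hlx, ← mul_assoc, h x hx, mul_assoc, mul_comm_of_mem_zpowers hy hc, mul_assoc]
    rwa [← this, mul_assoc, hl, mul_one]
  have hK1 : ∀ a ∈ K, a ∈ Subgroup.zpowers r → a = 1 :=
    fun a ha hy => hcentral a hy fun b hb => hK a ha b hb
  have hcard : Nat.card K = Nat.card G := by
    have h1 := card_eq_of_factorization G _ hX hG1
    rw [card_eq_of_factorization K _ hXK hK1] at h1
    exact Nat.eq_of_mul_eq_mul_right Nat.card_pos h1
  -- Induction principle expressing that K is generated by the ⟨r⟩-conjugates of x.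
  have hmem : ∀ {P : X → Prop}, P 1 → (∀ a ∈ K, ∀ b ∈ K, P a → P b → P (a * b)) →
      (∀ a ∈ K, P a → P a⁻¹) → (∀ a ∈ K, P a → ∀ y ∈ Subgroup.zpowers r, P (y * a * y⁻¹)) →
      P x → ∀ a ∈ K, P a := by
    intro P one mul inv conj hPx a ha
    obtain ⟨k, ⟨hk, hPk⟩, y, hy, h⟩ := exists_mul_zpowers_of_closure (P := fun g => g ∈ K ∧ P g)
      hrl hc hlx ⟨one_mem _, one⟩
      (fun a b ha hb => ⟨mul_mem ha.1 hb.1, mul a ha.1 b hb.1 ha.2 hb.2⟩)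
      (fun a ha => ⟨inv_mem ha.1, inv a ha.1 ha.2⟩)
      (fun a ha y hy => ⟨hKconj a ha.1 y, conj a ha.1 ha.2 y hy⟩) ⟨hx, hPx⟩ a
    have : y = 1 := hK1 y (by rw [← inv_mul_eq_iff_eq_mul.2 h]; exact mul_mem (inv_mem hk) ha) hy
    rwa [h, this, mul_one]
  have hcinv : c * x * c⁻¹ = x⁻¹ ∧ c * c = 1 := by
    -- This is l² = 1. It puts c² in K ∩ ⟨r⟩ = 1, and what remains says that c inverts x.
    have h1 : (x * (c * x * c⁻¹)) * (c * c) = 1 := by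
      rw [← hl, hlx]; group
    have h2 : c * c = 1 := by
      refine hK1 _ ?_ (mul_mem hc hc)
      rw [eq_inv_of_mul_eq_one_right h1]
      exact inv_mem (mul_mem hx (hKconj x hx c))
    rw [h2, mul_one] at h1
    exact ⟨(inv_eq_of_mul_eq_one_right h1).symm, h2⟩
  have hcyc : IsCyclic (X ⧸ K) := by
    refine ⟨(r : X ⧸ K), fun g => ?_⟩
    obtain ⟨g, rfl⟩ := QuotientGroup.mk_surjective g
    obtain ⟨a, ha, _, ⟨i, rfl⟩, rfl⟩ := hXK g
    refine ⟨i, ?_⟩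
    simp [(QuotientGroup.eq_one_iff a).2 ha]
  have hxp : x ^ p = 1 := by
    have hxz : x * (c * y⁻¹) = s := by
      rw [← mul_assoc, ← hlx, hsy]; group
    -- With z = cy⁻¹, xz = s lies in G. Modulo K, z agrees with s, so z^p ∈ K ∩ ⟨r⟩ = 1.
    refine pow_eq_one_of_mul_mem hp hp2 K G hK hcomm hG hcard hx (z := c * y⁻¹) ?_ (by rwa [hxz])
    refine hK1 _ ?_ (pow_mem (mul_mem hc (inv_mem hy)) p)
    have h1 : ((x * (c * y⁻¹)) ^ p : X) = 1 := by rw [hxz]; exact hG s hs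
    rw [← QuotientGroup.eq_one_iff, QuotientGroup.mk_pow]
    have h2 := congrArg (QuotientGroup.mk : X → X ⧸ K) h1
    rw [QuotientGroup.mk_pow, QuotientGroup.mk_mul, (QuotientGroup.eq_one_iff x).2 hx, one_mul] at h2
    exact h2
  refine ⟨K, hKn, hK, ?_, hK1, hXK, x, hx, c, hc, hlx, ?_⟩
  · refine hmem (one_pow p) (fun a ha b hb h1 h2 => ?_) (fun a _ h => ?_)
      (fun a _ h y _ => ?_) hxp
    · rw [(show Commute a b from hK a ha b hb).mul_pow, h1, h2, one_mul]
    · rw [inv_pow, h, inv_one]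
    · rw [conj_pow, h, mul_one, mul_inv_cancel]
  · refine hmem (by simp) (fun a ha b hb h1 h2 => ?_) (fun a _ h => ?_)
      (fun a _ h y hy => ?_) hcinv.1
    · rw [← conj_mul, h1, h2, hK a ha b hb, mul_inv_rev]
    · rw [← conj_inv, h]
    · have h1 := mul_comm_of_mem_zpowers hc hy
      calc c * (y * a * y⁻¹) * c⁻¹ = (c * y) * a * (c * y)⁻¹ := by group
        _ = y * (c * a * c⁻¹) * y⁻¹ := by rw [h1]; group
        _ = _ := by rw [h]; group

theorem exists_isAdaptedComplement {p : ℕ} (hp : p.Prime) {G : Subgroup X}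
    {r l : X} (hcomm : ∀ a ∈ G, ∀ b ∈ G, a * b = b * a) (hG : ∀ a ∈ G, a ^ p = 1)
    (hG1 : ∀ a ∈ G, a ∈ Subgroup.zpowers r → a = 1)
    (hX : ∀ g, ∃ a ∈ G, ∃ y ∈ Subgroup.zpowers r, g = a * y)
    (hl : l * l = 1) (hrl : Subgroup.closure {r, l} = ⊤)
    (hcore : ∀ y ∈ Subgroup.zpowers r, l * y * l ∈ Subgroup.zpowers r → y = 1) :
    ∃ Q, IsAdaptedComplement p r l Q := by
  by_cases hp2 : p = 2
  · subst hp2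
    exact ⟨G, isAdaptedComplement_two hcomm hG hG1 hX hrl hcore⟩
  · exact exists_isAdaptedComplement_odd hp hp2 hcomm hG hG1 hX hl hrl hcore

end OddFactorization

/-! ### Isomorphism and regularity of maps -/

namespace RotationSystem

theorem Isomorphic.symm {M N : RotationSystem} (h : M.Isomorphic N) : N.Isomorphic M := by
  obtain ⟨f, h1, h2⟩ := h
  exact ⟨f.symm, fun d => by rw [Equiv.symm_apply_eq, h1, Equiv.apply_symm_apply],
    fun d => by rw [Equiv.symm_apply_eq, h2, Equiv.apply_symm_apply]⟩

theorem Isomorphic.trans {M N P : RotationSystem} (h : M.Isomorphic N) (h' : N.Isomorphic P) :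
    M.Isomorphic P := by
  obtain ⟨f, h1, h2⟩ := h
  obtain ⟨g, h3, h4⟩ := h'
  exact ⟨f.trans g, fun d => by simp [h1, h3], fun d => by simp [h2, h4]⟩

theorem isRegular_iff {M : RotationSystem} : M.IsRegular ↔
    ∀ d e : M.D, ∃! f : Equiv.Perm M.D, f ∈ M.automorphismGroup ∧ f d = e := by
  refine forall₂_congr fun d e => ?_
  constructor
  · rintro ⟨⟨f, hf⟩, h1, h2⟩
    exact ⟨f, ⟨hf, h1⟩, fun g hg => congrArg Subtype.val (h2 ⟨g, hg.1⟩ hg.2)⟩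
  · rintro ⟨f, ⟨hf, h1⟩, h2⟩
    exact ⟨⟨f, hf⟩, h1, fun g hg => Subtype.ext (h2 g ⟨g.2, hg⟩)⟩

theorem IsRegular.of_isomorphic {M N : RotationSystem} (hM : M.IsRegular) (h : M.Isomorphic N) :
    N.IsRegular := by
  obtain ⟨f, h1, h2⟩ := h
  have h1' : ∀ d, f.symm (N.rot d) = M.rot (f.symm d) := fun d => by
    rw [Equiv.symm_apply_eq, h1, Equiv.apply_symm_apply]
  have h2' : ∀ d, f.symm (N.rev d) = M.rev (f.symm d) := fun d => by
    rw [Equiv.symm_apply_eq, h2, Equiv.apply_symm_apply]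
  rw [isRegular_iff] at hM ⊢
  intro d e
  obtain ⟨g, ⟨hg, hgd⟩, huniq⟩ := hM (f.symm d) (f.symm e)
  refine ⟨(f.symm.trans g).trans f, ⟨⟨fun x => ?_, fun x => ?_⟩, ?_⟩, ?_⟩
  · simp [h1', hg.1, h1]
  · simp [h2', hg.2, h2]
  · simp [hgd]
  · rintro k ⟨hk, hkd⟩
    have := huniq ((f.trans k).trans f.symm)
      ⟨⟨fun x => by simp [h1, hk.1, h1'], fun x => by simp [h2, hk.2, h2']⟩, by simp [hkd]⟩
    rw [← this]
    ext x
    simp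

end RotationSystem

/-! ### Isomorphisms and automorphisms of algebraic maps -/

section AlgebraicMap

variable {X : Type*} [Group X] {Y : Type*} [Group Y]

theorem algebraicMap_isomorphic (e : X ≃* Y) (r l : X) :
    (algebraicMap X r l).Isomorphic (algebraicMap Y (e r) (e l)) :=
  ⟨e.toEquiv, fun d : X => map_mul e d r, fun d : X => map_mul e d l⟩

/-- A map morphism between algebraic maps that preserves the identity is multiplicative. -/
theorem map_mul_of_commute_generators {r l : X} {r' l' : Y}
    (hrl : Subgroup.closure {r, l} = ⊤) {f : X → Y} (hone : f 1 = 1)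
    (hr : ∀ x, f (x * r) = f x * r') (hl : ∀ x, f (x * l) = f x * l') (x y : X) :
    f (x * y) = f x * f y := by
  have key : ∃ y', ∀ x, f (x * y) = f x * y' := by
    have hy : y ∈ Subgroup.closure {r, l} := hrl ▸ Subgroup.mem_top y
    induction hy using Subgroup.closure_induction with
    | mem g hg =>
      rcases hg with rfl | rfl
      · exact ⟨r', hr⟩
      · exact ⟨l', hl⟩
    | one => exact ⟨1, by simp⟩
    | mul g h _ _ hg hh =>
      obtain ⟨g', hg⟩ := hg
      obtain ⟨h', hh⟩ := hh
      exact ⟨g' * h', fun x => by rw [← mul_assoc, hh, hg, mul_assoc]⟩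
    | inv g _ hg =>
      obtain ⟨g', hg⟩ := hg
      exact ⟨g'⁻¹, fun x => by rw [eq_mul_inv_iff_mul_eq, ← hg, inv_mul_cancel_right]⟩
  obtain ⟨y', hy'⟩ := key
  have := hy' 1
  rw [one_mul, hone, one_mul] at this
  rw [hy', this]

theorem exists_mulEquiv_of_isomorphic {r l : X} {r' l' : Y}
    (hrl : Subgroup.closure {r, l} = ⊤)
    (h : (algebraicMap X r l).Isomorphic (algebraicMap Y r' l')) :
    ∃ e : X ≃* Y, e r = r' ∧ e l = l' := by
  obtain ⟨f, h1, h2⟩ := h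
  change X ≃ Y at f
  have h1' : ∀ x, f (x * r) = f x * r' := h1
  have h2' : ∀ x, f (x * l) = f x * l' := h2
  -- Left multiplications are map automorphisms, so the identity may be assumed fixed.
  let g : X ≃ Y := f.trans (Equiv.mulLeft (f 1)⁻¹)
  have hg : ∀ x, g x = (f 1)⁻¹ * f x := fun _ => rfl
  have hone : g 1 = 1 := by simp [hg]
  have hr : ∀ x, g (x * r) = g x * r' := fun x => by simp only [hg, h1', mul_assoc]
  have hl : ∀ x, g (x * l) = g x * l' := fun x => by simp only [hg, h2', mul_assoc]
  refine ⟨MulEquiv.mk' g (map_mul_of_commute_generators hrl hone hr hl), ?_, ?_⟩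
  · show g r = r'
    simpa [hone] using hr 1
  · show g l = l'
    simpa [hone] using hl 1

theorem algebraicMap_isRegular {r l : X} (hrl : Subgroup.closure {r, l} = ⊤) :
    (algebraicMap X r l).IsRegular := by
  rw [RotationSystem.isRegular_iff]
  intro d e
  change X at d e
  refine ⟨(Equiv.mulLeft (e * d⁻¹) : Equiv.Perm X), ⟨⟨fun x : X => ?_, fun x : X => ?_⟩, ?_⟩, ?_⟩
  · exact (mul_assoc (e * d⁻¹) x r).symm
  · exact (mul_assoc (e * d⁻¹) x l).symm
  · exact inv_mul_cancel_right e d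
  · rintro k ⟨⟨hk1, hk2⟩, hkd⟩
    change Equiv.Perm X at k
    have h1 : ∀ x, k (x * r) = k x * r := hk1
    have h2 : ∀ x, k (x * l) = k x * l := hk2
    -- Normalized to fix 1, an automorphism is a homomorphism that fixes both generators, hence the
    -- identity.
    have hmul : ∀ x, k x = k 1 * x := fun x => by
      have := map_mul_of_commute_generators (f := fun x => (k 1)⁻¹ * k x) (r' := r) (l' := l) hrl
        (by simp) (fun x => by simp only [h1, mul_assoc]) (fun x => by simp only [h2, mul_assoc])
      have hid : ∀ x, (k 1)⁻¹ * k x = x := by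
        intro x
        have hx : x ∈ Subgroup.closure {r, l} := hrl ▸ Subgroup.mem_top x
        induction hx using Subgroup.closure_induction with
        | mem g hg =>
          rcases hg with rfl | rfl
          · rw [← one_mul g, h1]; simp
          · rw [← one_mul g, h2]; simp
        | one => simp
        | mul a b _ _ ha hb => rw [this, ha, hb]
        | inv a _ ha =>
          have h3 := this a a⁻¹
          rw [ha, mul_inv_cancel, inv_mul_cancel] at h3
          exact (inv_eq_of_mul_eq_one_right h3.symm).symm
      exact (inv_mul_eq_iff_eq_mul.1 (hid x))
    have hkd' : k d = e := hkd
    ext x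
    show k x = e * d⁻¹ * x
    rw [hmul, ← hkd', hmul d]; group

end AlgebraicMap

/-! ### The groups T ⋊ ⟨σ⟩ and their generators -/

section AffineGroup

variable {n p : ℕ} {σ : GLnp n p}

theorem GLnp.neg_one_mul_self : (-1 : GLnp n p) * -1 = 1 := by
  ext v
  simp

theorem GLnp.neg_one_pow {k : ℕ} (hk : Odd k) : (-1 : GLnp n p) ^ k = -1 := by
  obtain ⟨j, rfl⟩ := hk
  rw [pow_succ, pow_mul, sq, neg_one_mul_self, one_pow, one_mul]

theorem GLnp.inv_neg_one : (-1 : GLnp n p)⁻¹ = -1 := inv_eq_of_mul_eq_one_right neg_one_mul_self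

namespace AffineGroup

theorem trans_add (v w : Fin n → ZMod p) : trans σ (v + w) = trans σ v * trans σ w :=
  map_mul SemidirectProduct.inl (Multiplicative.ofAdd v) (Multiplicative.ofAdd w)

theorem trans_zero : trans σ (0 : Fin n → ZMod p) = 1 := map_one SemidirectProduct.inl

theorem trans_neg (v : Fin n → ZMod p) : trans σ (-v) = (trans σ v)⁻¹ :=
  map_inv SemidirectProduct.inl (Multiplicative.ofAdd v)

theorem trans_injective : Function.Injective (trans σ) := fun _ _ h =>
  Multiplicative.ofAdd.injective (SemidirectProduct.inl_injective h)

theorem lin_mul (c d : GLnp n p) (hc : c ∈ Subgroup.zpowers σ) (hd : d ∈ Subgroup.zpowers σ) :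
    lin σ (c * d) (mul_mem hc hd) = lin σ c hc * lin σ d hd :=
  map_mul SemidirectProduct.inr (⟨c, hc⟩ : Subgroup.zpowers σ) ⟨d, hd⟩

theorem lin_one : lin σ 1 (one_mem _) = 1 := map_one SemidirectProduct.inr

theorem lin_zpow (k : ℤ) : lin σ (σ ^ k) (zpow_mem (Subgroup.mem_zpowers σ) k) = lin σ σ (Subgroup.mem_zpowers σ) ^ k :=
  map_zpow SemidirectProduct.inr (⟨σ, Subgroup.mem_zpowers σ⟩ : Subgroup.zpowers σ) k

theorem lin_congr {c d : GLnp n p} (h : c = d) (hc : c ∈ Subgroup.zpowers σ)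
    (hd : d ∈ Subgroup.zpowers σ) : lin σ c hc = lin σ d hd := by subst h; rfl

theorem eq_trans_mul_lin (x : AffineGroup σ) :
    ∃ v c, ∃ hc : c ∈ Subgroup.zpowers σ, x = trans σ v * lin σ c hc :=
  ⟨x.left.toAdd, x.right.1, x.right.2, (SemidirectProduct.inl_left_mul_inr_right x).symm⟩

theorem trans_mul_lin_mul_trans (v w : Fin n → ZMod p) (c : GLnp n p)
    (hc : c ∈ Subgroup.zpowers σ) :
    trans σ v * lin σ c hc * trans σ w = trans σ (v + (c⁻¹).1 w) * lin σ c hc := by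
  have h : trans σ w = trans σ (c.1 ((c⁻¹).1 w)) := by
    congr 1
    exact (LinearMap.congr_fun (congrArg Units.val (mul_inv_cancel c)) w).symm
  rw [h, ← conj_eq σ c hc, trans_add]
  group

end AffineGroup

open AffineGroup

theorem arcReversal_mul_self (hσ : IsAdmissible σ) (t : Fin n → ZMod p) :
    arcReversal σ hσ t * arcReversal σ hσ t = 1 := by
  rw [arcReversal, ← mul_assoc, trans_mul_lin_mul_trans, mul_assoc, ← lin_mul]
  rw [lin_congr GLnp.neg_one_mul_self _ (one_mem _), lin_one, mul_one]
  have : t + ((-1 : GLnp n p)⁻¹).1 t = 0 := by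
    rw [GLnp.inv_neg_one]
    exact add_neg_cancel t
  rw [this, trans_zero]

/-- The conjugates of t by powers of σ generate T. If t(-I) were trivial, its linear part would give
-I = I and then t = 0, impossible for n > 0. -/
theorem isAlgebraicMapData_standard [Fact p.Prime] (hn : 0 < n) (hσ : IsAdmissible σ)
    {t : Fin n → ZMod p} (ht : IsCyclicVector σ t) :
    IsAlgebraicMapData (AffineGroup σ) (lin σ σ (Subgroup.mem_zpowers σ))
      (arcReversal σ hσ t) := by
  constructor
  · set H := Subgroup.closure {lin σ σ (Subgroup.mem_zpowers σ), arcReversal σ hσ t} with hH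
    have hlin : ∀ c (hc : c ∈ Subgroup.zpowers σ), lin σ c hc ∈ H := by
      rintro _ ⟨k, rfl⟩
      rw [lin_zpow]
      exact zpow_mem (Subgroup.subset_closure (by simp)) k
    have htH : trans σ t ∈ H := by
      have h1 : arcReversal σ hσ t ∈ H := Subgroup.subset_closure (by simp)
      have := mul_mem h1 (inv_mem (hlin (-1) hσ.2))
      rwa [arcReversal, mul_inv_cancel_right] at this
    have htrans : ∀ v, trans σ v ∈ H := ht.mem_of_forall_pow_mem
      { carrier := {v | trans σ v ∈ H}
        zero_mem' := by
          show trans σ 0 ∈ H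
          rw [trans_zero]; exact one_mem _
        add_mem' := fun {v w} hv hw => by
          show trans σ (v + w) ∈ H
          rw [trans_add]; exact mul_mem hv hw
        neg_mem' := fun {v} hv => by
          show trans σ (-v) ∈ H
          rw [trans_neg]; exact inv_mem hv } fun i => by
      show trans σ ((σ ^ i).1 t) ∈ H
      have hi : σ ^ i ∈ Subgroup.zpowers σ := pow_mem (Subgroup.mem_zpowers σ) i
      rw [← conj_eq σ _ hi]
      exact mul_mem (mul_mem (inv_mem (hlin _ hi)) htH) (hlin _ hi)
    refine eq_top_iff.2 fun x _ => ?_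
    obtain ⟨v, c, hc, rfl⟩ := eq_trans_mul_lin x
    exact mul_mem (htrans v) (hlin c hc)
  · rw [orderOf_eq_prime_iff]
    refine ⟨by rw [sq]; exact arcReversal_mul_self hσ t, fun h => ht.ne_zero hn ?_⟩
    have h1 : (-1 : GLnp n p) = 1 := congrArg Subtype.val (congrArg SemidirectProduct.right h)
    rw [arcReversal, lin_congr h1 _ (one_mem _), lin_one, mul_one, ← trans_zero] at h
    exact trans_injective h

/-- Once the powers equal to -I are matched, `e` takes t₁ to t₂. Conjugates of t₁ by powers of σ₁
generate T, so `e` restricts to an additive map of T intertwining σ₁ and σ₂. -/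
theorem isConj_of_mulEquiv [hp : Fact p.Prime] {σ₁ σ₂ : GLnp n p} (h₁ : IsAdmissible σ₁)
    (h₂ : IsAdmissible σ₂) {t₁ t₂ : Fin n → ZMod p} (ht₁ : IsCyclicVector σ₁ t₁)
    (e : AffineGroup σ₁ ≃* AffineGroup σ₂)
    (hr : e (lin σ₁ σ₁ (Subgroup.mem_zpowers σ₁)) = lin σ₂ σ₂ (Subgroup.mem_zpowers σ₂))
    (hl : e (arcReversal σ₁ h₁ t₁) = arcReversal σ₂ h₂ t₂) : IsConj σ₁ σ₂ := by
  have hpow : ∀ k : ℤ, e (lin σ₁ (σ₁ ^ k) (zpow_mem (Subgroup.mem_zpowers σ₁) k)) =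
      lin σ₂ (σ₂ ^ k) (zpow_mem (Subgroup.mem_zpowers σ₂) k) := fun k => by
    rw [lin_zpow, map_zpow, hr, lin_zpow]
  obtain ⟨k, hk⟩ := h₁.2
  have hk' : σ₁ ^ k = -1 := hk
  -- the isomorphism matches the two copies of `-1`
  have hneg : σ₂ ^ k = -1 := by
    have hsq : (σ₂ ^ k) ^ 2 = 1 := by
      have h1 := hpow (k * 2)
      rw [lin_congr (show σ₁ ^ (k * 2) = 1 by rw [zpow_mul, hk']; exact (sq _).trans GLnp.neg_one_mul_self) _ (one_mem _),
        lin_one, map_one] at h1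
      have h2 := congrArg Subtype.val (congrArg SemidirectProduct.right h1)
      rw [← zpow_natCast, ← zpow_mul]
      exact h2.symm
    rcases hp.1.eq_two_or_odd' with rfl | ⟨j, hj⟩
    · have h11 : (-1 : GLnp n 2) = 1 := by
        refine Units.ext (LinearMap.ext fun v => funext fun i => ?_)
        exact ZMod.neg_eq_self_mod_two _
      have h1 := hpow k
      rw [lin_congr (hk'.trans h11) _ (one_mem _), lin_one, map_one] at h1
      have h2 := congrArg Subtype.val (congrArg SemidirectProduct.right h1)
      rw [h11]
      exact h2.symm
    -- It is not yet known that `e` sends t₁ into T, but its linear part is killed by p. The p-th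
    -- power of this equation reads σ₂^k = -1, as p is odd and σ₂^k squares to 1.
    · have hright : (e (trans σ₁ t₁)).right.1 * σ₂ ^ k = -1 := by
        rw [arcReversal, map_mul, lin_congr hk'.symm _ (zpow_mem (Subgroup.mem_zpowers σ₁) k), hpow] at hl
        exact congrArg Subtype.val (congrArg SemidirectProduct.right hl)
      have htp : (e (trans σ₁ t₁)).right.1 ^ p = 1 := by
        have h1 : trans σ₁ t₁ ^ p = 1 := by
          have : trans σ₁ t₁ ^ p = trans σ₁ (p • t₁) :=
            (map_pow SemidirectProduct.inl (Multiplicative.ofAdd t₁) p).symm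
          rw [this, show p • t₁ = 0 by ext i; simp, trans_zero]
        have h2 := congrArg (fun x => (SemidirectProduct.rightHom (e x)).1) h1
        simp only [map_pow, map_one] at h2
        exact h2
      have hc : Commute (e (trans σ₁ t₁)).right.1 (σ₂ ^ k) :=
        mul_comm_of_mem_zpowers (e (trans σ₁ t₁)).right.2 ⟨k, rfl⟩
      have h3 := hc.mul_pow p
      rw [hright, htp, one_mul, GLnp.neg_one_pow ⟨j, hj⟩, (congrArg ((σ₂ ^ k) ^ ·) hj :
        (σ₂ ^ k) ^ p = (σ₂ ^ k) ^ (2 * j + 1)), pow_succ, pow_mul, hsq, one_pow, one_mul] at h3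
      exact h3.symm
  have ht : e (trans σ₁ t₁) = trans σ₂ t₂ := by
    rw [arcReversal, arcReversal, map_mul, lin_congr hk'.symm _ (zpow_mem (Subgroup.mem_zpowers σ₁) k), hpow,
      lin_congr hneg _ h₂.2] at hl
    exact mul_right_cancel hl
  have hall : ∀ v, ∃ w : Fin n → ZMod p, e (trans σ₁ v) = trans σ₂ w := ht₁.mem_of_forall_pow_mem
    { carrier := {v | ∃ w : Fin n → ZMod p, e (trans σ₁ v) = trans σ₂ w}
      zero_mem' := ⟨0, by rw [trans_zero, trans_zero, map_one]⟩
      add_mem' := by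
        rintro v v' ⟨w, hw⟩ ⟨w', hw'⟩
        exact ⟨w + w', by rw [trans_add, trans_add, map_mul, hw, hw']⟩
      neg_mem' := by
        rintro v ⟨w, hw⟩
        exact ⟨-w, by rw [trans_neg, trans_neg, map_inv, hw]⟩ } fun i => by
    refine ⟨(σ₂ ^ i).1 t₂, ?_⟩
    have h1 := hpow i
    simp only [zpow_natCast] at h1
    rw [← conj_eq σ₁ (σ₁ ^ i) (pow_mem (Subgroup.mem_zpowers σ₁) i), map_mul, map_mul, map_inv, ht,
      h1, conj_eq]
  choose φ hφ using hall
  have hφadd : ∀ v w, φ (v + w) = φ v + φ w := fun v w => trans_injective (σ := σ₂) (by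
    rw [← hφ, trans_add, map_mul, hφ, hφ, trans_add])
  have hφσ : ∀ v, φ (σ₁.1 v) = σ₂.1 (φ v) := fun v => trans_injective (σ := σ₂) (by
    rw [← hφ, ← conj_eq σ₁ _ (Subgroup.mem_zpowers σ₁), map_mul, map_mul, map_inv, hφ, hr, conj_eq])
  have hφinj : Function.Injective φ := fun v w h => trans_injective (σ := σ₁) (e.injective (by
    rw [hφ, hφ, h]))
  let L : Module.End (ZMod p) (Fin n → ZMod p) :=
    (AddMonoidHom.mk' φ hφadd).toZModLinearMap p
  obtain ⟨B, hB⟩ : IsUnit L :=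
    (Module.End.isUnit_iff L).2 ⟨hφinj, LinearMap.injective_iff_surjective.1 hφinj⟩
  refine isConj_iff.2 ⟨B, mul_inv_eq_iff_eq_mul.2 (Units.ext ?_)⟩
  show B.1 * σ₁.1 = σ₂.1 * B.1
  rw [hB]
  exact LinearMap.ext hφσ

end AffineGroup

open AffineGroup

/-! ### Recognizing T ⋊ ⟨σ⟩ inside a group -/

section Transfer

variable {n p : ℕ} {σ : GLnp n p} {X : Type*} [Group X]

/-- Conjugation by powers of `r` corresponds to the powers of `σ`. -/
theorem conj_zpow_of_conj {f : Multiplicative (Fin n → ZMod p) →* X} {r : X}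
    (hrel : ∀ v, f (Multiplicative.ofAdd (σ.1 v)) = r⁻¹ * f (Multiplicative.ofAdd v) * r)
    (k : ℤ) (v : Fin n → ZMod p) :
    f (Multiplicative.ofAdd ((σ ^ k).1 v)) = r ^ (-k) * f (Multiplicative.ofAdd v) * r ^ k := by
  have hinv : ∀ v, f (Multiplicative.ofAdd ((σ⁻¹).1 v)) =
      r * f (Multiplicative.ofAdd v) * r⁻¹ := fun v => by
    have h := hrel ((σ⁻¹).1 v)
    have h2 : σ.1 ((σ⁻¹).1 v) = v :=
      LinearMap.congr_fun (congrArg Units.val (mul_inv_cancel σ)) v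
    rw [h2] at h
    rw [h]; group
  induction k generalizing v with
  | zero => simp
  | succ k ih =>
    rw [zpow_add_one]
    exact (ih (σ.1 v)).trans (by rw [hrel]; group)
  | pred k ih =>
    rw [zpow_sub_one]
    exact (ih ((σ⁻¹).1 v)).trans (by rw [hinv]; group)

theorem mem_zpowers_zpowers_generator (y : X) (z : Subgroup.zpowers y) :
    z ∈ Subgroup.zpowers (⟨y, Subgroup.mem_zpowers y⟩ : Subgroup.zpowers y) := by
  obtain ⟨_, i, rfl⟩ := z
  exact ⟨i, rfl⟩

/-- A group with a complemented normal subgroup on which `r⁻¹` acts as `σ` does is `T ⋊ ⟨σ⟩`. -/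
theorem exists_mulEquiv_affineGroup {f : Multiplicative (Fin n → ZMod p) →* X} {r : X}
    (hf : Function.Injective f)
    (hrel : ∀ v, f (Multiplicative.ofAdd (σ.1 v)) = r⁻¹ * f (Multiplicative.ofAdd v) * r)
    (hone : ∀ v, f v ∈ Subgroup.zpowers r → f v = 1)
    (hmul : ∀ g, ∃ v, ∃ y ∈ Subgroup.zpowers r, g = f v * y)
    (hcent : ∀ y ∈ Subgroup.zpowers r, (∀ v, y * f v = f v * y) → y = 1) :
    ∃ e : AffineGroup σ ≃* X, (∀ v, e (trans σ v) = f (Multiplicative.ofAdd v)) ∧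
      ∀ k : ℤ, e (lin σ (σ ^ k) (zpow_mem (Subgroup.mem_zpowers σ) k)) = r ^ k := by
  have hk := conj_zpow_of_conj hrel
  -- ⟨r⟩ acts faithfully by `hcent`, so r^i and σ^i are trivial for the same i.
  have horder : orderOf σ = orderOf r := by
    rw [orderOf_eq_orderOf_iff]
    intro i
    have hki := hk i
    simp only [zpow_neg, zpow_natCast] at hki
    constructor
    · intro h
      refine hcent _ (pow_mem (Subgroup.mem_zpowers r) i) fun v => ?_
      have := hki v.toAdd
      rw [h] at this
      have h2 : f v = (r ^ i)⁻¹ * f v * r ^ i := this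
      rw [mul_assoc, eq_inv_mul_iff_mul_eq] at h2
      exact h2
    · intro h
      refine Units.ext (LinearMap.ext fun v => ?_)
      have := hki v
      rw [h, inv_one, one_mul, mul_one] at this
      exact Multiplicative.ofAdd.injective (hf this)
  let e₀ : Subgroup.zpowers σ ≃* Subgroup.zpowers r := mulEquivOfOrderOfEq
    (mem_zpowers_zpowers_generator σ) (mem_zpowers_zpowers_generator r) (by
      rw [Subgroup.orderOf_mk, Subgroup.orderOf_mk, horder])
  have he₀ : ∀ k : ℤ, e₀ ⟨σ ^ k, zpow_mem (Subgroup.mem_zpowers σ) k⟩ =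
      ⟨r ^ k, zpow_mem (Subgroup.mem_zpowers r) k⟩ := fun k => by
    have h1 : e₀ ⟨σ, Subgroup.mem_zpowers σ⟩ = ⟨r, Subgroup.mem_zpowers r⟩ :=
      mulEquivOfOrderOfEq_apply_gen _ _ _
    exact (map_zpow e₀ ⟨σ, Subgroup.mem_zpowers σ⟩ k).trans (congrArg (· ^ k) h1)
  let F : AffineGroup σ →* X := SemidirectProduct.lift f ((Subgroup.zpowers r).subtype.comp e₀) (by
    rintro ⟨_, k, rfl⟩
    refine MonoidHom.ext fun v => ?_
    have h1 := hk (-k) v.toAdd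
    have h2 : (e₀ ⟨σ ^ k, zpow_mem (Subgroup.mem_zpowers σ) k⟩ : X) = r ^ k :=
      congrArg Subtype.val (he₀ k)
    show f (Multiplicative.ofAdd (((σ ^ k)⁻¹).1 v.toAdd)) =
      e₀ ⟨σ ^ k, zpow_mem (Subgroup.mem_zpowers σ) k⟩ * f v *
        (e₀ ⟨σ ^ k, zpow_mem (Subgroup.mem_zpowers σ) k⟩ : X)⁻¹
    rw [h2, ← zpow_neg, h1, neg_neg, zpow_neg]
    rfl)
  have hF1 : ∀ v, F (trans σ v) = f (Multiplicative.ofAdd v) := fun v =>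
    SemidirectProduct.lift_inl _ _ _ _
  have hF2 : ∀ k : ℤ, F (lin σ (σ ^ k) (zpow_mem (Subgroup.mem_zpowers σ) k)) = r ^ k := fun k =>
    (SemidirectProduct.lift_inr _ _ _ _).trans (congrArg Subtype.val (he₀ k))
  refine ⟨MulEquiv.ofBijective F ⟨?_, fun g => ?_⟩, hF1, hF2⟩
  · rw [injective_iff_map_eq_one]
    intro x hx
    obtain ⟨v, _, ⟨k, rfl⟩, rfl⟩ := eq_trans_mul_lin x
    have h1 : F (trans σ v) * r ^ k = 1 := by rw [← hF2, ← map_mul]; exact hx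
    rw [hF1] at h1
    have h2 := hone (Multiplicative.ofAdd v) (by
      rw [eq_inv_of_mul_eq_one_left h1]
      exact inv_mem (zpow_mem (Subgroup.mem_zpowers r) k))
    have h3 : v = 0 := Multiplicative.ofAdd.injective (hf (h2.trans (map_one f).symm))
    rw [h2, one_mul] at h1
    have h4 : (⟨σ ^ k, zpow_mem (Subgroup.mem_zpowers σ) k⟩ : Subgroup.zpowers σ) = 1 :=
      e₀.injective ((he₀ k).trans ((Subtype.ext h1).trans (map_one e₀).symm))
    rw [h3, trans_zero, one_mul]
    exact (congrArg SemidirectProduct.inr h4).trans (map_one _)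
  · obtain ⟨v, _, ⟨k, rfl⟩, rfl⟩ := hmul g
    refine ⟨trans σ v.toAdd * lin σ (σ ^ k) (zpow_mem (Subgroup.mem_zpowers σ) k), ?_⟩
    rw [map_mul, hF1, hF2]
    rfl

end Transfer

/-! ### From an adapted complement to a standard map -/

theorem exists_linearEquiv_pi_zmod {n p : ℕ} [hp : Fact p.Prime] {V : Type*} [AddCommGroup V]
    [Module (ZMod p) V] (hcard : Nat.card V = p ^ n) :
    Nonempty (V ≃ₗ[ZMod p] (Fin n → ZMod p)) := by
  have : Finite V := Nat.finite_of_card_ne_zero (by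
    rw [hcard]; exact pow_ne_zero _ hp.1.ne_zero)
  have h1 := Module.natCard_eq_pow_finrank (K := ZMod p) (V := V)
  have h2 : Module.finrank (ZMod p) V = n := by
    rw [Nat.card_zmod] at h1
    exact Nat.pow_right_injective hp.1.two_le (h1.symm.trans hcard)
  exact ⟨LinearEquiv.ofFinrankEq V (Fin n → ZMod p) (by simp [h2])⟩

/-- A finite group of exponent `p` that is commutative is a coordinate space over `𝔽_p`. -/
theorem exists_mulEquiv_pi_zmod {n p : ℕ} [Fact p.Prime] {Q : Type*} [Group Q]
    (hcomm : ∀ a b : Q, a * b = b * a) (hexp : ∀ a : Q, a ^ p = 1) (hcard : Nat.card Q = p ^ n) :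
    Nonempty (Q ≃* Multiplicative (Fin n → ZMod p)) := by
  let _ : CommGroup Q := { ‹Group Q› with mul_comm := hcomm }
  let _ : Module (ZMod p) (Additive Q) := AddCommGroup.zmodModule fun x => hexp x.toMul
  obtain ⟨e⟩ := exists_linearEquiv_pi_zmod (V := Additive Q) hcard
  exact ⟨AddEquiv.toMultiplicativeRight e.toAddEquiv⟩

/-- The algebraic map of a group with an adapted elementary abelian complement is one of the maps
`M(T ⋊ ⟨σ⟩; σ, t(-I))`. -/
theorem IsAdaptedComplement.exists_isomorphic {n p : ℕ} [Fact p.Prime] {X : Type*} [Group X]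
    [Finite X] {r l : X} {Q : Subgroup X} (hQ : IsAdaptedComplement p r l Q)
    (hcard : Nat.card Q = p ^ n) (hl : l * l = 1) (hrl : Subgroup.closure {r, l} = ⊤)
    (hcore : ∀ y ∈ Subgroup.zpowers r, l * y * l ∈ Subgroup.zpowers r → y = 1)
    {R : Set (GLnp n p)} (hR : IsRepresentativeSet R) :
    ∃ σ ∈ R, ∃ hσ : IsAdmissible σ, ∀ t, IsCyclicVector σ t →
      (algebraicMap X r l).Isomorphic (standardMap σ hσ t) := by
  obtain ⟨e⟩ := exists_mulEquiv_pi_zmod (Q := Q) (n := n) (p := p)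
    (fun a b => Subtype.ext (hQ.comm a a.2 b b.2)) (fun a => Subtype.ext (hQ.pow_eq_one a a.2)) hcard
  obtain ⟨x, hx, c, hc, hlx, hinv⟩ := hQ.exists_inversion
  let f : Multiplicative (Fin n → ZMod p) →* X := Q.subtype.comp e.symm.toMonoidHom
  have hf : Function.Injective f := Subtype.val_injective.comp e.symm.injective
  have hfQ : ∀ v, f v ∈ Q := fun v => (e.symm v).2
  have hfsurj : ∀ a ∈ Q, ∃ v : Fin n → ZMod p, f (Multiplicative.ofAdd v) = a := fun a ha =>
    ⟨(e ⟨a, ha⟩).toAdd, congrArg Subtype.val (e.symm_apply_apply ⟨a, ha⟩)⟩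
  have hfadd : ∀ v w, f (Multiplicative.ofAdd (v + w)) =
      f (Multiplicative.ofAdd v) * f (Multiplicative.ofAdd w) := fun v w =>
    map_mul f (Multiplicative.ofAdd v) (Multiplicative.ofAdd w)
  have hinjf : ∀ v w, f (Multiplicative.ofAdd v) = f (Multiplicative.ofAdd w) → v = w :=
    fun v w h => Multiplicative.ofAdd.injective (hf h)
  -- the linear map induced by conjugation with `r⁻¹`
  choose φ hφ using fun v => hfsurj _
    (by simpa using hQ.normal.conj_mem _ (hfQ (Multiplicative.ofAdd v)) r⁻¹ :
      r⁻¹ * f (Multiplicative.ofAdd v) * r ∈ Q)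
  let L : Module.End (ZMod p) (Fin n → ZMod p) := (AddMonoidHom.mk' φ fun v w => hinjf _ _ (by
    rw [hφ, hfadd, hfadd, hφ, hφ]; group)).toZModLinearMap p
  have hLinj : Function.Injective L := fun v w h => hinjf _ _ (by
    have h1 := hφ v
    rw [show φ v = φ w from h, hφ w] at h1
    exact (mul_left_cancel (mul_right_cancel h1)).symm)
  obtain ⟨τ, hτ⟩ : IsUnit L :=
    (Module.End.isUnit_iff L).2 ⟨hLinj, LinearMap.injective_iff_surjective.1 hLinj⟩
  have hrel : ∀ v, f (Multiplicative.ofAdd (τ.1 v)) = r⁻¹ * f (Multiplicative.ofAdd v) * r :=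
    fun v => by rw [hτ]; exact hφ v
  have hk := conj_zpow_of_conj (σ := τ) hrel
  obtain ⟨x₀, hx₀⟩ := hfsurj x hx
  have hcent : ∀ y ∈ Subgroup.zpowers r, (∀ a ∈ Q, y * a = a * y) → y = 1 := by
    intro y hy h
    refine hcore y hy ?_
    have : y * l = l * y := by
      rw [hlx, ← mul_assoc, h x hx, mul_assoc, mul_comm_of_mem_zpowers hy hc, mul_assoc]
    rwa [← this, mul_assoc, hl, mul_one]
  -- The image of the τ-span of x₀ is normalized by ⟨r⟩ and contains x. As r and l generate X, its
  -- product with ⟨r⟩ is X, so it is all of Q.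
  have hspan : Submodule.span (ZMod p) (Set.range fun i : ℕ => (τ.1 ^ i) x₀) = ⊤ := by
    set W := Submodule.span (ZMod p) (Set.range fun i : ℕ => (τ.1 ^ i) x₀) with hW
    have hWτ : ∀ j : ℕ, ∀ w ∈ W, (τ.1 ^ j) w ∈ W := fun j w hw => by
      have : W ≤ W.comap (τ.1 ^ j) := by
        refine Submodule.span_le.2 ?_
        rintro _ ⟨i, rfl⟩
        refine Submodule.subset_span ⟨j + i, ?_⟩
        show (τ.1 ^ (j + i)) x₀ = (τ.1 ^ j) ((τ.1 ^ i) x₀)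
        rw [pow_add]; rfl
      exact this hw
    refine eq_top_iff.2 fun v _ => ?_
    obtain ⟨k, ⟨w, hw, rfl⟩, y, hy, h⟩ := exists_mul_zpowers_of_closure
      (P := fun g => ∃ w ∈ W, g = f (Multiplicative.ofAdd w)) hrl hc hlx
      ⟨0, zero_mem _, (map_one f).symm⟩
      (by rintro _ _ ⟨v, hv, rfl⟩ ⟨w, hw, rfl⟩; exact ⟨v + w, add_mem hv hw, (hfadd v w).symm⟩)
      (by rintro _ ⟨v, hv, rfl⟩; exact ⟨-v, neg_mem hv, (map_inv f _).symm⟩)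
      (by
        rintro _ ⟨v, hv, rfl⟩ y hy
        -- X is finite, so nonnegative powers of r, and hence of τ, suffice.
        obtain ⟨j, hj⟩ := mem_powers_iff_mem_zpowers.2 (inv_mem hy)
        refine ⟨(τ.1 ^ j) v, hWτ j v hv, ?_⟩
        have h1 := hk j v
        simp only [zpow_neg, zpow_natCast] at h1
        rw [show r ^ j = y⁻¹ from hj, inv_inv] at h1
        rw [← h1]; simp)
      ⟨x₀, Submodule.subset_span ⟨0, by simp⟩, hx₀.symm⟩ (f (Multiplicative.ofAdd v))
    have hy1 : y = 1 := hQ.eq_one y (by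
      rw [← inv_mul_eq_iff_eq_mul.2 h]; exact mul_mem (inv_mem (hfQ _)) (hfQ _)) hy
    rw [hy1, mul_one] at h
    rwa [hinjf v w h]
  obtain ⟨hdeg, hcyc⟩ := isCyclicVector_of_span hspan
  -- Stated for arbitrary coordinates: it serves τ with `f`, and later σ with `g`.
  have hneg : ∀ (ρ : GLnp n p) (g : Multiplicative (Fin n → ZMod p) →* X),
      Function.Injective g → (∀ v, g v ∈ Q) →
      (∀ v, g (Multiplicative.ofAdd (ρ.1 v)) = r⁻¹ * g (Multiplicative.ofAdd v) * r) →
      ∃ k : ℤ, ρ ^ k = -1 ∧ r ^ k = c := by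
    intro ρ g hg hgQ hrel
    obtain ⟨k, hkc⟩ := hc
    have hkc' : r ^ k = c := hkc
    refine ⟨k, ?_, hkc⟩
    have h1 : ρ ^ (-k) = -1 := by
      refine Units.ext (LinearMap.ext fun v => Multiplicative.ofAdd.injective (hg ?_))
      rw [conj_zpow_of_conj hrel, neg_neg, zpow_neg, hkc', hinv _ (hgQ _), ← map_inv]
      rfl
    rw [← neg_neg k, zpow_neg, h1, GLnp.inv_neg_one]
  have hτadm : IsAdmissible τ := by
    obtain ⟨k, h1, -⟩ := hneg τ f hf hfQ hrel
    exact ⟨hdeg, k, h1⟩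
  obtain ⟨σ, ⟨hσR, hconj⟩, -⟩ := hR.2 τ hτadm
  refine ⟨σ, hσR, hR.1 σ hσR, fun t ht => ?_⟩
  obtain ⟨A, hA⟩ := isConj_iff.1 hconj
  have hAτ : A * τ = σ * A := by rw [← hA]; group
  have hApow : ∀ i : ℕ, A * τ ^ i = σ ^ i * A := fun i => by
    rw [← hA, conj_pow]; group
  have hAx : IsCyclicVector σ (A.1 x₀) := by
    refine (isCyclicVector_of_span ?_).2
    have h1 := congrArg (Submodule.map A.1) hspan
    rw [Submodule.map_span, ← Set.range_comp, Submodule.map_top, LinearMap.range_eq_top.2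
      ((Module.End.isUnit_iff A.1).1 A.isUnit).2] at h1
    rw [← h1]
    congr 2
    funext i
    have := LinearMap.congr_fun (congrArg Units.val (hApow i)) x₀
    simpa using this.symm
  obtain ⟨B, hBσ, hBt⟩ := hAx.exists_commute ht
  -- coordinates adapted to `σ` and `t`
  set C := B * A with hC
  have hCτ : C * τ = σ * C := by
    rw [hC, mul_assoc, hAτ, ← mul_assoc, hBσ.eq, mul_assoc]
  have hCσ : C⁻¹ * σ = τ * C⁻¹ := by
    rw [inv_mul_eq_iff_eq_mul, ← mul_assoc, hCτ, mul_inv_cancel_right]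
  let g : Multiplicative (Fin n → ZMod p) →* X :=
    f.comp (AddMonoidHom.toMultiplicative (C⁻¹).1.toAddMonoidHom)
  have hgf : ∀ v, g (Multiplicative.ofAdd v) = f (Multiplicative.ofAdd ((C⁻¹).1 v)) := fun _ => rfl
  have hCinv : ∀ v, (C⁻¹).1 (C.1 v) = v := fun v =>
    LinearMap.congr_fun (congrArg Units.val (inv_mul_cancel C)) v
  have hg : Function.Injective g := fun v w h => Multiplicative.toAdd.injective
    (((Module.End.isUnit_iff (C⁻¹).1).1 (C⁻¹).isUnit).1 (hinjf _ _ h))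
  have hgsurj : ∀ a ∈ Q, ∃ v, g v = a := fun a ha => by
    obtain ⟨v, rfl⟩ := hfsurj a ha
    exact ⟨Multiplicative.ofAdd (C.1 v), by rw [hgf, hCinv]⟩
  have hgQ : ∀ v, g v ∈ Q := fun v => hfQ _
  have hgrel : ∀ v, g (Multiplicative.ofAdd (σ.1 v)) = r⁻¹ * g (Multiplicative.ofAdd v) * r :=
    fun v => by
      have h1 : (C⁻¹).1 (σ.1 v) = τ.1 ((C⁻¹).1 v) :=
        LinearMap.congr_fun (congrArg Units.val hCσ) v
      rw [hgf, h1, hrel, hgf]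
  obtain ⟨E, hE1, hE2⟩ := exists_mulEquiv_affineGroup hg hgrel (fun v hv => hQ.eq_one _ (hgQ v) hv)
    (fun a => by
      obtain ⟨q, hq, y, hy, rfl⟩ := hQ.exists_mul a
      obtain ⟨v, rfl⟩ := hgsurj q hq
      exact ⟨v, y, hy, rfl⟩)
    (fun y hy h => hcent y hy fun a ha => by
      obtain ⟨v, rfl⟩ := hgsurj a ha
      exact h v)
  have hEr : E (lin σ σ (Subgroup.mem_zpowers σ)) = r := by
    have := hE2 1
    simpa using this
  have hEl : E (arcReversal σ (hR.1 σ hσR) t) = l := by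
    obtain ⟨k, hk1, hk2⟩ := hneg σ g hg hgQ hgrel
    rw [arcReversal, map_mul, hE1, lin_congr hk1.symm _ (zpow_mem (Subgroup.mem_zpowers σ) k), hE2,
      hk2, hlx, hgf, ← hBt, ← hx₀]
    congr 3
    exact hCinv x₀
  have := algebraicMap_isomorphic E (lin σ σ (Subgroup.mem_zpowers σ))
    (arcReversal σ (hR.1 σ hσR) t)
  rw [hEr, hEl] at this
  exact this.symm

/-! ### The automorphism group of a regular Cayley map -/

namespace CayleyMap

variable {G : Type*} [Group G]

/-- The dart `(g, s)` of a Cayley map. -/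
def dart (C : CayleyMap G) (g : G) (s : C.S) : C.toMap.D := ((g, s) : G × C.S)

theorem exists_eq_dart (C : CayleyMap G) (d : C.toMap.D) : ∃ g s, d = C.dart g s := ⟨d.1, d.2, rfl⟩

theorem dart_inj (C : CayleyMap G) {g h : G} {s t : C.S} (H : C.dart g s = C.dart h t) :
    g = h ∧ s = t := Prod.mk.inj H

theorem rot_dart (C : CayleyMap G) (g : G) (s : C.S) :
    C.toMap.rot (C.dart g s) = C.dart g (C.ρ s) := rfl

theorem rev_dart (C : CayleyMap G) (g : G) (s : C.S) :
    C.toMap.rev (C.dart g s) = C.dart (g * s) ⟨(s : G)⁻¹, C.inv_mem _ s.2⟩ := rfl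

theorem rev_rev (C : CayleyMap G) (d : C.toMap.D) : C.toMap.rev (C.toMap.rev d) = d := by
  obtain ⟨g, s, rfl⟩ := C.exists_eq_dart d
  rw [rev_dart, rev_dart]
  congr 1
  · exact mul_inv_cancel_right g (s : G)
  · exact Subtype.ext (inv_inv (s : G))

theorem rot_zpow_dart (C : CayleyMap G) (k : ℤ) (g : G) (s : C.S) :
    (C.toMap.rot ^ k) (C.dart g s) = C.dart g ((C.ρ ^ k) s) := by
  induction k generalizing s with
  | zero => rfl
  | succ k ih => rw [zpow_add_one, zpow_add_one, Equiv.Perm.mul_apply, rot_dart, ih]; rfl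
  | pred k ih =>
    have h : C.toMap.rot⁻¹ (C.dart g s) = C.dart g (C.ρ⁻¹ s) := by
      rw [Equiv.Perm.inv_eq_iff_eq, rot_dart]; exact congrArg _ (Equiv.apply_symm_apply C.ρ s).symm
    rw [zpow_sub_one, zpow_sub_one, Equiv.Perm.mul_apply, h, ih]; rfl

/-- Left translations are automorphisms of a Cayley map. -/
def translation (C : CayleyMap G) : G →* C.toMap.automorphismGroup where
  toFun g := ⟨((Equiv.mulLeft g).prodCongr (Equiv.refl C.S) : Equiv.Perm (G × C.S)),
    fun _ => rfl, fun d : G × C.S => Prod.ext (mul_assoc g d.1 d.2.1).symm rfl⟩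
  map_one' := Subtype.ext (Equiv.ext fun d : G × C.S => Prod.ext (one_mul d.1) rfl)
  map_mul' g h := Subtype.ext (Equiv.ext fun d : G × C.S => Prod.ext (mul_assoc g h d.1) rfl)

theorem translation_apply (C : CayleyMap G) (g h : G) (s : C.S) :
    (C.translation g).1 (C.dart h s) = C.dart (g * h) s := rfl

theorem exists_zpow_eq (C : CayleyMap G) (s t : C.S) : ∃ k : ℤ, (C.ρ ^ k) s = t :=
  C.cyclic.2 (Set.mem_univ s) (Set.mem_univ t)

theorem nonempty_S [Nontrivial G] (C : CayleyMap G) : Nonempty C.S := by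
  by_contra h
  rw [Set.nonempty_coe_sort, Set.not_nonempty_iff_eq_empty] at h
  have := C.closure_eq_top
  rw [h, Subgroup.closure_empty] at this
  exact bot_ne_top this

/-- The graph of a Cayley map is connected. -/
theorem mem_of_closed (C : CayleyMap G) {P : C.toMap.D → Prop} {d : C.toMap.D}
    (hd : P d) (hrot : ∀ d, ∀ k : ℤ, P d → P ((C.toMap.rot ^ k) d))
    (hrev : ∀ d, P d → P (C.toMap.rev d)) (e : C.toMap.D) : P e := by
  have hall : ∀ (g : G) (s t : C.S), P (C.dart g s) → P (C.dart g t) := by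
    intro g s t h
    obtain ⟨k, hk⟩ := C.exists_zpow_eq s t
    rw [← hk, ← rot_zpow_dart]
    exact hrot _ k h
  have hstep : ∀ x ∈ Subgroup.closure C.S, ∀ g,
      (∀ t, P (C.dart g t)) ↔ ∀ t, P (C.dart (g * x) t) := by
    intro x hx
    induction hx using Subgroup.closure_induction with
    | mem x hx =>
      refine fun g => ⟨fun h t => hall _ _ t (hrev _ (h ⟨x, hx⟩)), fun h t => ?_⟩
      have h1 := hrev _ (h ⟨x⁻¹, C.inv_mem _ hx⟩)
      rw [rev_dart] at h1
      simp only [mul_inv_cancel_right] at h1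
      exact hall _ _ t h1
    | one => simp
    | mul x y _ _ hx hy => exact fun g => by rw [hx g, hy (g * x), mul_assoc]
    | inv x _ hx => exact fun g => by rw [hx (g * x⁻¹), inv_mul_cancel_right]
  obtain ⟨g, s, rfl⟩ := C.exists_eq_dart d
  obtain ⟨h, t, rfl⟩ := C.exists_eq_dart e
  have := (hstep (g⁻¹ * h) (C.closure_eq_top ▸ Subgroup.mem_top _) g).1 (fun t => hall _ _ t hd) t
  rwa [mul_inv_cancel_left] at this

/-- The group-theoretic description of a regular Cayley map: its automorphism
group `X = G⟨r⟩` is generated by `r` and the involution `l`, with `⟨r⟩` the stabilizer of a vertex,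
and the map is `M(X; r, l)`. -/
theorem exists_algebraicMap [Nontrivial G] (C : CayleyMap G) (hC : C.IsRegular) :
    ∃ r l : C.toMap.automorphismGroup,
      (algebraicMap C.toMap.automorphismGroup r l).Isomorphic C.toMap ∧ l * l = 1 ∧
      Subgroup.closure {r, l} = ⊤ ∧
      (∀ y ∈ Subgroup.zpowers r, l * y * l ∈ Subgroup.zpowers r → y = 1) ∧
      (∀ a ∈ C.translation.range, a ∈ Subgroup.zpowers r → a = 1) ∧
      (∀ f, ∃ a ∈ C.translation.range, ∃ y ∈ Subgroup.zpowers r, f = a * y) := by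
  obtain ⟨s₀⟩ := C.nonempty_S
  set d₀ : C.toMap.D := C.dart 1 s₀ with hd₀
  have hex : ∀ e : C.toMap.D, ∃ f : C.toMap.automorphismGroup, f.1 d₀ = e := fun e =>
    (hC d₀ e).exists
  have hinj : ∀ f g : C.toMap.automorphismGroup, f.1 d₀ = g.1 d₀ → f = g := fun f g h =>
    (hC d₀ (g.1 d₀)).unique h rfl
  have hmul : ∀ (f g : C.toMap.automorphismGroup) (d), (f * g).1 d = f.1 (g.1 d) := fun _ _ _ => rfl
  have hone : ∀ d, (1 : C.toMap.automorphismGroup).1 d = d := fun _ => rfl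
  have hfrev : ∀ (f : C.toMap.automorphismGroup) (d), f.1 (C.toMap.rev d) = C.toMap.rev (f.1 d) :=
    fun f => f.2.2
  have hfrot : ∀ (f : C.toMap.automorphismGroup) (k : ℤ) (d),
      f.1 ((C.toMap.rot ^ k) d) = (C.toMap.rot ^ k) (f.1 d) := fun f k d => by
    have h : Commute f.1 C.toMap.rot := Equiv.ext f.2.1
    exact Equiv.congr_fun (h.zpow_right k).eq d
  obtain ⟨r, hr⟩ := hex (C.toMap.rot d₀)
  obtain ⟨l, hl⟩ := hex (C.toMap.rev d₀)
  -- Only at d₀ do r and the rotation agree; the powers follow because automorphisms commute with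
  -- the rotation.
  have hrpow : ∀ k : ℤ, (r ^ k).1 d₀ = (C.toMap.rot ^ k) d₀ := by
    intro k
    induction k with
    | zero => rfl
    | succ k ih =>
      have h1 := hfrot (r ^ (k : ℤ)) 1 d₀
      rw [zpow_one, ih] at h1
      rw [zpow_add_one, hmul, hr, h1, add_comm, zpow_one_add]; rfl
    | pred k ih =>
      have hr' : (r⁻¹).1 d₀ = (C.toMap.rot ^ (-1 : ℤ)) d₀ := by
        have h1 := hfrot r⁻¹ (-1) (C.toMap.rot d₀)
        rw [← hr, ← hmul, inv_mul_cancel, hone, hr] at h1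
        rw [← h1]
        congr 1
        exact (Equiv.symm_apply_apply C.toMap.rot d₀).symm
      have h1 := hfrot (r ^ (-k : ℤ)) (-1) d₀
      rw [ih] at h1
      rw [zpow_sub_one, hmul, hr', h1, sub_eq_neg_add, zpow_add]; rfl
  have hll : l * l = 1 := hinj _ _ (by rw [hmul, hl, hfrev, hl, rev_rev, hone])
  refine ⟨r, l, ?_, hll, ?_, ?_, ?_, ?_⟩
  · refine ⟨Equiv.ofBijective (fun f : C.toMap.automorphismGroup => f.1 d₀)
      ⟨fun f g h => hinj f g h, hex⟩, fun f : C.toMap.automorphismGroup => ?_,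
      fun f : C.toMap.automorphismGroup => ?_⟩
    · exact (congrArg f.1 hr).trans (f.2.1 d₀)
    · exact (congrArg f.1 hl).trans (hfrev f d₀)
  · refine eq_top_iff.2 fun f _ => ?_
    obtain ⟨g, hg, h⟩ := C.mem_of_closed (d := d₀)
      (P := fun e => ∃ g ∈ Subgroup.closure {r, l}, g.1 d₀ = e) ⟨1, one_mem _, rfl⟩
      (by
        rintro _ k ⟨g, hg, rfl⟩
        exact ⟨g * r ^ k, mul_mem hg (zpow_mem (Subgroup.subset_closure (by simp)) k),
          by rw [hmul, hrpow, hfrot]⟩)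
      (by
        rintro _ ⟨g, hg, rfl⟩
        exact ⟨g * l, mul_mem hg (Subgroup.subset_closure (by simp)), by rw [hmul, hl, hfrev]⟩)
      (f.1 d₀)
    rwa [← hinj g f h]
  -- Applied to d₀, the two sides of l r^j = r^k l are darts based at s₀ and at ρ^k(s₀). Hence ρ^k
  -- fixes s₀ and r^k fixes d₀.
  · rintro _ ⟨k, rfl⟩ ⟨j, hj⟩
    change r ^ j = l * r ^ k * l at hj
    have h2 : l * r ^ j = r ^ k * l := by
      rw [hj, ← mul_assoc, ← mul_assoc, hll, one_mul]
    have h3 : (l * r ^ j).1 d₀ = (r ^ k * l).1 d₀ := by rw [h2]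
    rw [hmul, hmul, hrpow, hfrot, hl, hfrev, hrpow, hd₀, rot_zpow_dart, rev_dart, rot_zpow_dart,
      rev_dart, one_mul, one_mul] at h3
    refine hinj _ _ ?_
    show (r ^ k).1 d₀ = d₀
    rw [hrpow, hd₀, rot_zpow_dart, ← Subtype.ext (C.dart_inj h3).1]
  · rintro _ ⟨g, rfl⟩ ⟨k, hk⟩
    have h1 : (C.translation g).1 d₀ = (C.toMap.rot ^ k) d₀ := by
      rw [← hrpow]; exact congrArg (fun f => f.1 d₀) hk.symm
    rw [hd₀, translation_apply, rot_zpow_dart, mul_one] at h1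
    rw [(C.dart_inj h1).1, map_one]
  · intro f
    obtain ⟨g, s, hgs⟩ := C.exists_eq_dart (f.1 d₀)
    obtain ⟨k, hk⟩ := C.exists_zpow_eq s₀ s
    refine ⟨C.translation g, ⟨g, rfl⟩, r ^ k, ⟨k, rfl⟩, hinj _ _ ?_⟩
    rw [hgs, hmul, hrpow, hd₀, rot_zpow_dart, hk, translation_apply, mul_one]

theorem translation_injective (C : CayleyMap G) (s : C.S) : Function.Injective C.translation := by
  intro g h hgh
  have := congrArg (fun f => f.1 (C.dart 1 s)) hgh
  simp only [translation_apply, mul_one] at this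
  exact (C.dart_inj this).1

end CayleyMap

/-- Every regular Cayley map of `ℤ_p ^ n` is one of the maps `M(T ⋊ ⟨σ⟩; σ, t(-I))`. -/
theorem CayleyMap.exists_isomorphic_standardMap {n p : ℕ} [hp : Fact p.Prime] (hn : 0 < n)
    {R : Set (GLnp n p)} (hR : IsRepresentativeSet R) {G : Type*} [Group G]
    (e : G ≃* Multiplicative (Fin n → ZMod p)) (C : CayleyMap G) (hC : C.IsRegular) :
    ∃ σ ∈ R, ∃ hσ : IsAdmissible σ, ∀ t, IsCyclicVector σ t →
      C.toMap.Isomorphic (standardMap σ hσ t) := by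
  have hfin : Finite G := Finite.of_equiv _ e.symm.toEquiv
  have : NeZero n := ⟨hn.ne'⟩
  have hnt : Nontrivial G := e.toEquiv.nontrivial
  obtain ⟨r, l, hiso, hl, hrl, hcore, hone, hmul⟩ := C.exists_algebraicMap hC
  have hfinD : Finite C.toMap.D := inferInstanceAs (Finite (G × C.S))
  have hfinX : Finite C.toMap.automorphismGroup := inferInstance
  have hs : Nonempty C.S := C.nonempty_S
  have hcardG : Nat.card C.translation.range = p ^ n := by
    rw [← Nat.card_congr (MonoidHom.ofInjective (C.translation_injective hs.some)).toEquiv,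
      Nat.card_congr e.toEquiv]
    show Nat.card (Fin n → ZMod p) = p ^ n
    simp
  obtain ⟨Q, hQ⟩ := exists_isAdaptedComplement hp.1 (G := C.translation.range)
    (by
      rintro _ ⟨a, rfl⟩ _ ⟨b, rfl⟩
      have : a * b = b * a := e.injective (by rw [map_mul, map_mul, mul_comm])
      rw [← map_mul, this, map_mul])
    (by
      rintro _ ⟨a, rfl⟩
      have : a ^ p = 1 := e.injective (by
        rw [map_pow, map_one]
        refine Multiplicative.toAdd.injective ?_
        ext i
        simp)
      rw [← map_pow, this, map_one])
    hone hmul hl hrl hcore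
  have hcardQ : Nat.card Q = p ^ n := by
    have h1 := card_eq_of_factorization _ _ hmul hone
    rw [card_eq_of_factorization Q _ hQ.exists_mul hQ.eq_one] at h1
    rw [Nat.eq_of_mul_eq_mul_right Nat.card_pos h1, hcardG]
  obtain ⟨σ, hσR, hσ, h⟩ := hQ.exists_isomorphic hcardQ hl hrl hcore hR
  exact ⟨σ, hσR, hσ, fun t ht => hiso.symm.trans (h t ht)⟩

/-! ### The standard maps as Cayley maps -/

section StandardCayleyMap

variable {n p : ℕ} {σ : GLnp n p}

/-- The orbit of `t` under `⟨σ⟩`. -/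
def zpowersOrbit (σ : GLnp n p) (t : Fin n → ZMod p) : Set (Multiplicative (Fin n → ZMod p)) :=
  {v | ∃ c ∈ Subgroup.zpowers σ, v = Multiplicative.ofAdd (c.1 t)}

theorem apply_mem_zpowersOrbit {t : Fin n → ZMod p} {c : GLnp n p} (hc : c ∈ Subgroup.zpowers σ)
    {v : Multiplicative (Fin n → ZMod p)} (hv : v ∈ zpowersOrbit σ t) :
    Multiplicative.ofAdd (c.1 v.toAdd) ∈ zpowersOrbit σ t := by
  obtain ⟨d, hd, rfl⟩ := hv
  exact ⟨c * d, mul_mem hc hd, rfl⟩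

theorem GLnp.inv_apply_apply (c : GLnp n p) (v : Fin n → ZMod p) : (c⁻¹).1 (c.1 v) = v :=
  LinearMap.congr_fun (congrArg Units.val (inv_mul_cancel c)) v

theorem GLnp.apply_inv_apply (c : GLnp n p) (v : Fin n → ZMod p) : c.1 ((c⁻¹).1 v) = v :=
  LinearMap.congr_fun (congrArg Units.val (mul_inv_cancel c)) v

/-- The permutation of the orbit of `t` induced by `σ⁻¹`. -/
def orbitRotation (σ : GLnp n p) (t : Fin n → ZMod p) : Equiv.Perm (zpowersOrbit σ t) where
  toFun v := ⟨_, apply_mem_zpowersOrbit (inv_mem (Subgroup.mem_zpowers σ)) v.2⟩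
  invFun v := ⟨_, apply_mem_zpowersOrbit (Subgroup.mem_zpowers σ) v.2⟩
  left_inv v := Subtype.ext (GLnp.apply_inv_apply σ v.1.toAdd)
  right_inv v := Subtype.ext (GLnp.inv_apply_apply σ v.1.toAdd)

theorem orbitRotation_zpow (t : Fin n → ZMod p) (k : ℤ) (v : zpowersOrbit σ t) :
    ((orbitRotation σ t ^ k) v : Multiplicative (Fin n → ZMod p)) =
      Multiplicative.ofAdd ((σ ^ (-k)).1 v.1.toAdd) := by
  induction k generalizing v with
  | zero => rfl
  | succ k ih =>
    rw [zpow_add_one, Equiv.Perm.mul_apply, ih, neg_add, zpow_add, zpow_neg_one]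
    rfl
  | pred k ih =>
    rw [zpow_sub_one, Equiv.Perm.mul_apply, ih, neg_sub, sub_neg_eq_add, add_comm, zpow_add_one,
      neg_neg]
    rfl

variable [Fact p.Prime]

/-- The balanced Cayley map of `T` on the orbit of a cyclic vector. -/
def standardCayleyMap (hn : 0 < n) (hσ : IsAdmissible σ) {t : Fin n → ZMod p}
    (ht : IsCyclicVector σ t) : CayleyMap (Multiplicative (Fin n → ZMod p)) where
  S := zpowersOrbit σ t
  one_notMem := by
    rintro ⟨c, -, hc⟩
    refine ht.ne_zero hn ?_
    rw [← GLnp.inv_apply_apply c t, show c.1 t = 0 from hc.symm, map_zero]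
  inv_mem := by
    -- Inversion in T is the action of -I ∈ ⟨σ⟩.
    exact fun v hv => apply_mem_zpowersOrbit hσ.2 hv
  closure_eq_top := by
    refine eq_top_iff.2 fun v _ => ?_
    let H : AddSubgroup (Fin n → ZMod p) :=
      { carrier := {v | Multiplicative.ofAdd v ∈ Subgroup.closure (zpowersOrbit σ t)}
        zero_mem' := Subgroup.one_mem (Subgroup.closure (zpowersOrbit σ t))
        add_mem' := fun {v w} hv hw => 
          Subgroup.mul_mem (Subgroup.closure (zpowersOrbit σ t)) hv hw
        neg_mem' := fun {v} hv =>
          Subgroup.inv_mem (Subgroup.closure (zpowersOrbit σ t)) (x := Multiplicative.ofAdd v) hv }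
    refine ht.mem_of_forall_pow_mem H (fun i => ?_) v.toAdd
    show Multiplicative.ofAdd ((σ ^ i).1 t) ∈ Subgroup.closure (zpowersOrbit σ t)
    exact Subgroup.subset_closure ⟨σ ^ i, pow_mem (Subgroup.mem_zpowers σ) i, rfl⟩
  ρ := orbitRotation σ t
  cyclic := by
    refine ⟨Set.bijOn_univ.2 (orbitRotation σ t).bijective, ?_⟩
    rintro ⟨_, _, ⟨i, rfl⟩, rfl⟩ - ⟨_, _, ⟨j, rfl⟩, rfl⟩ -
    -- The rotation is by σ⁻¹, so the exponent from σ^i(t) to σ^j(t) is i - j.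
    refine ⟨i - j, Subtype.ext ?_⟩
    rw [orbitRotation_zpow, neg_sub]
    show Multiplicative.ofAdd ((σ ^ (j - i) * σ ^ i).1 t) = Multiplicative.ofAdd ((σ ^ j).1 t)
    rw [← zpow_add, sub_add_cancel]

/-- Elements of ⟨σ⟩ commute with σ, so agreement at t spreads to all σ^i(t). -/
theorem IsCyclicVector.eq_of_apply_eq {t : Fin n → ZMod p} (ht : IsCyclicVector σ t)
    {c d : GLnp n p} (hc : c ∈ Subgroup.zpowers σ) (hd : d ∈ Subgroup.zpowers σ)
    (h : c.1 t = d.1 t) : c = d := by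
  refine Units.ext (LinearMap.ext fun v => ?_)
  refine ht.mem_of_forall_pow_mem (LinearMap.eqLocus c.1 d.1).toAddSubgroup (fun i => ?_) v
  have hi : σ ^ i ∈ Subgroup.zpowers σ := pow_mem (Subgroup.mem_zpowers σ) i
  show (c * σ ^ i).1 t = (d * σ ^ i).1 t
  rw [mul_comm_of_mem_zpowers hc hi, mul_comm_of_mem_zpowers hd hi]
  exact congrArg (σ ^ i).1 h

theorem standardMap_isomorphic_standardCayleyMap (hn : 0 < n) (hσ : IsAdmissible σ)
    {t : Fin n → ZMod p} (ht : IsCyclicVector σ t) :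
    (standardMap σ hσ t).Isomorphic (standardCayleyMap hn hσ ht).toMap := by
  -- The dart vc sits at v and points along c⁻¹(t): by the conjugation convention vc·t(-I) has
  -- T-part v + c⁻¹(t), and right multiplication by σ turns c⁻¹(t) into σ⁻¹c⁻¹(t).
  let F : AffineGroup σ → Multiplicative (Fin n → ZMod p) × zpowersOrbit σ t := fun x =>
    (x.left, ⟨Multiplicative.ofAdd ((x.right⁻¹).1.1 t), _, (x.right⁻¹).2, rfl⟩)
  have hF : Function.Bijective F := by
    constructor
    · intro x y hxy
      have h1 : x.left = y.left := congrArg Prod.fst hxy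
      have h2 : (x.right⁻¹).1.1 t = (y.right⁻¹).1.1 t :=
        congrArg (fun z => z.2.1.toAdd) hxy
      have h3 := ht.eq_of_apply_eq (x.right⁻¹).2 (y.right⁻¹).2 h2
      exact SemidirectProduct.ext h1 (inv_injective (Subtype.ext h3))
    · rintro ⟨v, ⟨_, c, hc, rfl⟩⟩
      refine ⟨⟨v, (⟨c, hc⟩ : Subgroup.zpowers σ)⁻¹⟩, Prod.ext rfl (Subtype.ext ?_)⟩
      show Multiplicative.ofAdd (((⟨c, hc⟩ : Subgroup.zpowers σ)⁻¹⁻¹).1.1 t) = _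
      rw [inv_inv]
  refine ⟨Equiv.ofBijective F hF, fun x : AffineGroup σ => ?_, fun x : AffineGroup σ => ?_⟩
  · show F (x * lin σ σ (Subgroup.mem_zpowers σ)) = ((F x).1, orbitRotation σ t (F x).2)
    refine Prod.ext ?_ (Subtype.ext ?_)
    · show x.left * affineAction σ x.right 1 = x.left
      rw [map_one, mul_one]
    · show Multiplicative.ofAdd
        (((x.right * ⟨σ, Subgroup.mem_zpowers σ⟩ : Subgroup.zpowers σ)⁻¹).1.1 t) =
          Multiplicative.ofAdd ((σ⁻¹ * (x.right⁻¹).1).1 t)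
      rw [mul_inv_rev]
      rfl
  · show F (x * arcReversal σ hσ t) = ((F x).1 * (F x).2.1, ⟨((F x).2.1)⁻¹, _⟩)
    refine Prod.ext ?_ (Subtype.ext ?_)
    · show x.left * affineAction σ x.right
        (Multiplicative.ofAdd t * affineAction σ 1 1) = x.left * _
      rw [map_one, mul_one]
      rfl
    · show Multiplicative.ofAdd (((x.right * (1 * ⟨-1, hσ.2⟩) : Subgroup.zpowers σ)⁻¹).1.1 t) =
          Multiplicative.ofAdd (-((x.right⁻¹).1.1 t))
      rw [one_mul, mul_inv_rev]
      show Multiplicative.ofAdd (((-1 : GLnp n p)⁻¹ * (x.right⁻¹).1).1 t) = _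
      rw [GLnp.inv_neg_one]
      rfl

end StandardCayleyMap

theorem theorem1p2 (n p : ℕ) [Fact p.Prime] (hn : 0 < n)
    (R : Set (GLnp n p)) (hR : IsRepresentativeSet R) :
    -- the maps `M(T ⋊ ⟨σ⟩; σ, t(-I))`, `σ ∈ R`, are well defined: suitable `t` exist, and for each
    -- of them `σ` and the involution `t(-I)` generate `T ⋊ ⟨σ⟩`
    (∀ σ ∈ R, ∃ t, IsCyclicVector σ t) ∧
    (∀ σ ∈ R, ∀ (hσ : IsAdmissible σ) (t : Fin n → ZMod p), IsCyclicVector σ t →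
      IsAlgebraicMapData (AffineGroup σ) (AffineGroup.lin σ σ (Subgroup.mem_zpowers σ))
        (arcReversal σ hσ t)) ∧
    -- every regular Cayley map of `ℤ_p ^ n` is isomorphic to one of them, for any choice of `t`
    (∀ (G : Type*) [Group G], Nonempty (G ≃* Multiplicative (Fin n → ZMod p)) →
      ∀ C : CayleyMap G, C.IsRegular →
        ∃ σ ∈ R, ∃ hσ : IsAdmissible σ, ∀ t, IsCyclicVector σ t →
          C.toMap.Isomorphic (standardMap σ hσ t)) ∧
    -- each of them is a regular Cayley map of `ℤ_p ^ n`
    (∀ σ ∈ R, ∀ (hσ : IsAdmissible σ) (t : Fin n → ZMod p), IsCyclicVector σ t →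
      ∃ C : CayleyMap (Multiplicative (Fin n → ZMod p)),
        C.IsRegular ∧ C.toMap.Isomorphic (standardMap σ hσ t)) ∧
    -- different `σ` in `R` give nonisomorphic maps
    (∀ σ₁ ∈ R, ∀ σ₂ ∈ R, ∀ (h₁ : IsAdmissible σ₁) (h₂ : IsAdmissible σ₂)
      (t₁ t₂ : Fin n → ZMod p), IsCyclicVector σ₁ t₁ → IsCyclicVector σ₂ t₂ → σ₁ ≠ σ₂ →
        ¬ (standardMap σ₁ h₁ t₁).Isomorphic (standardMap σ₂ h₂ t₂)) := by
  refine ⟨fun σ hσR => exists_isCyclicVector (hR.1 σ hσR),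
    fun σ _ hσ t ht => isAlgebraicMapData_standard hn hσ ht,
    fun G _ ⟨e⟩ C hC => C.exists_isomorphic_standardMap hn hR e hC,
    fun σ _ hσ t ht => ?_, fun σ₁ hσ₁ σ₂ hσ₂ h₁ h₂ t₁ t₂ ht₁ ht₂ hne hiso => hne ?_⟩
  · have hiso := standardMap_isomorphic_standardCayleyMap hn hσ ht
    exact ⟨standardCayleyMap hn hσ ht,
      (algebraicMap_isRegular (isAlgebraicMapData_standard hn hσ ht).1).of_isomorphic hiso,
      hiso.symm⟩
  · obtain ⟨e, hr, hl⟩ := exists_mulEquiv_of_isomorphic (isAlgebraicMapData_standard hn h₁ ht₁).1 hiso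
    -- Both elements are representatives of the class of σ₁.
    exact (hR.2 σ₁ h₁).unique ⟨hσ₁, IsConj.refl σ₁⟩
      ⟨hσ₂, isConj_of_mulEquiv h₁ h₂ ht₁ e hr hl⟩
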